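/- Let $X\neq\{0\}$ be a complex Banach space, $\mathcal B_r=\{x\in X:\|x\|<r\}$, and $J(x)=\{x^*\in X^*:\langle x,x^*\rangle=\|x\|^2=\|x^*\|^2\}$; suprema of $\operatorname{Re}\langle f(x),x^*\rangle$ are over all indicated $x$ and all $x^*\in J(x)$. Let $R>0$ and let $h:\mathcal B_R\to X$ be holomorphic. Let $N_R$ be either $\sup_{\|x\|<R}\operatorname{Re}\langle h(x),x^*\rangle$ or the boundary supremum $\limsup_{s\to R^-}\sup_{\|x\|=s}\operatorname{Re}\langle h(x),x^*\rangle$ (the result holds for each of the two choices), and assume $N_R<\infty$. Put $c=\|h(0)\|$, $b=N_R/R^2$, $L=\sup_{\|u\|=1}\operatorname{Re}\langle h'(0)u,u^*\rangle$ and, for $0<r<R$, $$\omega(r)=c\Bigl(1-\frac{r^2}{R^2}\Bigr)+\frac{r}{R+r}\bigl[(R-r)L+2rb\bigr],\qquad \mu(r)=\frac{\omega(r)}{r}.$$ (i) Let $0<r<R$. For all $z\in X$ and $\lambda\in\mathbb C$ with $\operatorname{Re}\lambda>\frac1r[\omega(r)+\|z\|]$, the equation $\lambda x-h(x)=z$ has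 a unique solution $x$ in $\mathcal B_r$, and $x=\Re(\lambda,h)(z)$. That is, if $\operatorname{Re}\lambda>\mu(r)$, there are open sets $D\subseteq\mathcal B_R$ with $0\in D$ and $W\subseteq X$ with $-h(0)\in W$ such that $\lambda I-h$ maps $D$ bijectively onto $W$ with holomorphic inverse $\Re(\lambda,h):W\to D$, and for every $z\in X$ with $\operatorname{Re}\lambda>\frac1r[\omega(r)+\|z\|]$ we have $z\in W$ and $\Re(\lambda,h)(z)\in\mathcal B_r$. (ii) Let $0<r<R$. For each real $\lambda>\mu(r)$ and each $y\in\mathcal B_r$, the equation $\lambda x-h(x)=(\lambda-\mu(r))y$ has a unique solution $x$ in $\mathcal B_r$. (iii) If $h(0)=0$, then $\mu$ has no strict (local) minimum in $(0,R)$: it is the constant $L$ on $(0,R)$ if $N_R=R^2L$, and it is strictly increasing on $(0,R)$ if $N_R\ne R^2L$. (iv) If $h(0)\neq0$, put $\beta=\dfrac{\sqrt{c^2+2R(b-L)c}-c}{c}$ and $r_*=R\,\dfrac{\beta-\sqrt{\beta^2-4}}{2}$. Then $r_*\in(0,R)$ and $\mu$ attains its minimum over $(0,R)$ at $r_*$ if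 and only if $$R\Bigl(\frac{N_R}{R^2}-L\Bigr)>4\|h(0)\|;$$ moreover, if $\mu$ has a local minimum at any point of $(0,R)$, then this inequality holds. -/

import Mathlib

open Set Filter Topology

noncomputable section

namespace HolRange

variable {X : Type*} [NormedAddCommGroup X] [NormedSpace ℂ X]

/-- The normalized duality mapping: `J(x) = {x* ∈ X* : ⟨x, x*⟩ = ‖x‖² = ‖x*‖²}`. -/
def dualityMap (x : X) : Set (X →L[ℂ] ℂ) :=
  {l | l x = ((‖x‖ ^ 2 : ℝ) : ℂ) ∧ ‖l‖ ^ 2 = ‖x‖ ^ 2}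

/-- `sup Re ⟨f(x), x*⟩` over all pairs `x ∈ S`, `x* ∈ J(x)`, as an extended real number. -/
def supRe (f : X → X) (S : Set X) : EReal :=
  ⨆ x ∈ S, ⨆ l ∈ dualityMap x, (((l (f x)).re : ℝ) : EReal)

/-- The supremum of `Re ⟨h(x), x*⟩` over the open ball `‖x‖ < R`. -/
def ballSup (h : X → X) (R : ℝ) : EReal := supRe h (Metric.ball 0 R)

/-- The boundary supremum of `Re ⟨h(x), x*⟩` at `‖x‖ = R`, for a mapping defined on the open ball
only: the upper limit of the suprema over the spheres `‖x‖ = s` as `s` increases to `R`. -/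
def boundarySup (h : X → X) (R : ℝ) : EReal :=
  limsup (fun s : ℝ => supRe h (Metric.sphere 0 s)) (𝓝[<] R)

/-- `L = sup_{‖u‖ = 1} Re ⟨h'(0)u, u*⟩`. It is finite on a nonzero space. -/
def derivSup (h : X → X) : ℝ := (supRe (fun u => fderiv ℂ h 0 u) (Metric.sphere 0 1)).toReal

/-- `ω(r)`, where `N` is the value of `N_R`. -/
def omegaFn (h : X → X) (R N r : ℝ) : ℝ :=
  ‖h 0‖ * (1 - r ^ 2 / R ^ 2) +
    r / (R + r) * ((R - r) * derivSup h + 2 * r * (N / R ^ 2))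

/-- `μ(r) = ω(r) / r`. -/
def muFn (h : X → X) (R N r : ℝ) : ℝ := omegaFn h R N r / r

/-- `β = (√(c² + 2R(b - L)c) - c) / c` with `b = N / R²` and `c = ‖h(0)‖`. -/
def betaCoeff (h : X → X) (R N : ℝ) : ℝ :=
  (Real.sqrt (‖h 0‖ ^ 2 + 2 * R * (N / R ^ 2 - derivSup h) * ‖h 0‖) - ‖h 0‖) / ‖h 0‖

/-- `r_* = R (β - √(β² - 4)) / 2`. -/
def rStar (h : X → X) (R N : ℝ) : ℝ :=
  R * ((betaCoeff h R N - Real.sqrt (betaCoeff h R N ^ 2 - 4)) / 2)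

/-- `Φ = (lam I - h)⁻¹` is the (nonlinear) resolvent of `h : B → X` at `lam`, with domain the open
set `W ∋ -h(0)` and with range the open set `D ⊆ B`, `0 ∈ D`: it is the holomorphic inverse of
`lam I - h : D → W`. -/
structure IsResolvent (h : X → X) (B : Set X) (lam : ℂ) (D W : Set X) (Φ : X → X) : Prop where
  isOpen_range : IsOpen D
  range_subset : D ⊆ B
  zero_mem : (0 : X) ∈ D
  isOpen_domain : IsOpen W
  neg_mem : -h 0 ∈ W
  mapsTo : MapsTo (fun x => lam • x - h x) D W
  mapsTo_inv : MapsTo Φ W D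
  invOn : InvOn Φ (fun x => lam • x - h x) D W
  holomorphic : DifferentiableOn ℂ Φ W

end HolRange

end

/-! Everything rests on one growth estimate: for `‖x‖ = r` and `l ∈ dualityMap x`, `Re l(h x) ≤ r
ω(r)`. Granting it, `G x = λ x - h x - z` satisfies `Re l(G x) ≥ r (r Re λ - ω(r) - ‖z‖)` on the
sphere of radius `r`. This is positive exactly under the hypothesis of (i), so `G` is strictly
accretive there and has a unique zero inside. Part (ii) is the case `z = (λ - μ(r)) y`.

The growth estimate is one-variable (`re_conj_mul_le`). Restrict `h` to a complex line and pair it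
with a functional to get a scalar `g`. The function `(g(ζ) - g(0))/ζ + conj(g(0)) ζ/s²` is
holomorphic, and on `|ζ| = s` its real part is `Re(conj ζ · g(ζ))/s²`. Harnack's inequality carries
the bound on that circle inwards, and then `s → R`.

The zero comes from the Earle–Hamilton theorem applied to `x - ε G x`
(`existsUnique_zero_of_bounded`). For this `G` must be bounded on a slightly larger ball, which is
not automatic in infinite dimensions. A one-sided bound on the numerical range bounds its modulus
(Borel–Carathéodory), Cauchy's estimates pass this to the Taylor polynomials, and Harris' inequality
turns their numerical radii into norms at the cost of a factor `4 m²`, harmless for convergence on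
smaller balls.

Parts (iii) and (iv) are algebra with a factored difference `μ(r) - μ(a)`, together with `R² L ≤ N`,
a mean value property. -/

noncomputable section

namespace HolRange

variable {X : Type*} [NormedAddCommGroup X] [NormedSpace ℂ X]

/-! ### The Earle–Hamilton fixed point theorem in a ball. -/

section EarleHamilton

open Metric

/-- Cauchy's estimate for the Fréchet derivative of a bounded holomorphic mapping. -/
theorem norm_fderiv_le_of_bounded {Y : Type*} [NormedAddCommGroup Y] [NormedSpace ℂ Y]
    {g : X → Y} {c : X} {ρ M : ℝ} (hρ : 0 < ρ)
    (hg : DifferentiableOn ℂ g (ball c ρ)) (hM : ∀ y ∈ ball c ρ, ‖g y‖ ≤ M) :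
    ‖fderiv ℂ g c‖ ≤ 2 * M / ρ := by
  refine Complex.norm_fderiv_le_div_of_mapsTo_ball hg (fun y hy => ?_) hρ
  rw [mem_closedBall, dist_eq_norm]
  have h1 := hM y hy
  have h2 := hM c (mem_ball_self hρ)
  linarith [norm_sub_le (g y) (g c)]

theorem ball_sub_norm_subset {E : Type*} [SeminormedAddCommGroup E] {r : ℝ} (x : E) :
    ball x (r - ‖x‖) ⊆ ball (0 : E) r := by
  refine ball_subset_ball' ?_
  simp [dist_eq_norm]

/-- Holomorphic self-maps do not increase the infinitesimal Carathéodory metric, and a map strictly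
inside the ball leaves room to be dilated by `1 + κ`. The induction keeps `g` arbitrary: with `w =
f^[n] x`, the dilation `F` of `f` about `f w` still maps the ball into itself, so `g ∘ F` has the
same bound `M`, while its derivative at `w` is `1 + κ` times that of `g ∘ f`. -/
theorem norm_fderiv_comp_iterate_le {f : X → X} {r η κ : ℝ}
    (hf : DifferentiableOn ℂ f (ball 0 r))
    (hmap : MapsTo f (ball 0 r) (closedBall 0 (r - η))) (hη : 0 < η)
    (hκ0 : 0 ≤ κ) (hκ : 2 * κ * r < η) (n : ℕ) :
    ∀ {g : X → X} {M : ℝ}, DifferentiableOn ℂ g (ball 0 r) → (∀ y ∈ ball 0 r, ‖g y‖ ≤ M) →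
      ∀ {x : X}, x ∈ ball (0 : X) r →
        (1 + κ) ^ n * ‖fderiv ℂ (g ∘ f^[n]) x‖ ≤ 2 * M / (r - ‖x‖) := by
  have hmap' : MapsTo f (ball 0 r) (ball 0 r) := fun y hy => by
    have := hmap hy
    rw [mem_closedBall_zero_iff] at this
    rw [mem_ball_zero_iff]; linarith
  induction n with
  | zero =>
    intro g M hg hM x hx
    have hx' : 0 < r - ‖x‖ := by rw [mem_ball_zero_iff] at hx; linarith
    simpa using norm_fderiv_le_of_bounded hx' (hg.mono (ball_sub_norm_subset x))
      fun y hy => hM y (ball_sub_norm_subset x hy)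
  | succ n ih =>
    intro g M hg hM x hx
    set w := f^[n] x with hw
    have hwm : w ∈ ball (0 : X) r := hmap'.iterate n hx
    have hfw : f w ∈ ball (0 : X) r := hmap' hwm
    set F : X → X := fun y => f y + (κ : ℂ) • (f y - f w) with hF
    have hFd : DifferentiableOn ℂ F (ball 0 r) := by fun_prop
    have hFm : MapsTo F (ball 0 r) (ball 0 r) := by
      intro y hy
      have h1 := mem_closedBall_zero_iff.1 (hmap hy)
      have h2 := mem_ball_zero_iff.1 (hmap' hy)
      have h3 := mem_ball_zero_iff.1 hfw
      rw [mem_ball_zero_iff]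
      have h4 : ‖F y‖ ≤ ‖f y‖ + κ * ‖f y - f w‖ := by
        refine (norm_add_le _ _).trans_eq ?_
        rw [norm_smul, Complex.norm_real, Real.norm_of_nonneg hκ0]
      have h5 : ‖f y - f w‖ ≤ 2 * r := by linarith [norm_sub_le (f y) (f w)]
      nlinarith
    have key := ih (hg.comp hFd hFm) (fun y hy => hM _ (hFm hy)) hx
    have hnd : ∀ k, DifferentiableOn ℂ f^[k] (ball 0 r) := by
      intro k
      induction k with
      | zero => exact differentiableOn_id
      | succ k ihk =>
        rw [Function.iterate_succ']
        exact hf.comp ihk (hmap'.iterate k)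
    have hxn := isOpen_ball.mem_nhds hx
    have hitd : HasFDerivAt f^[n] (fderiv ℂ f^[n] x) x :=
      ((hnd n).differentiableAt hxn).hasFDerivAt
    have hfd : HasFDerivAt f (fderiv ℂ f w) w :=
      (hf.differentiableAt (isOpen_ball.mem_nhds hwm)).hasFDerivAt
    have hgd : HasFDerivAt g (fderiv ℂ g (f w)) (f w) :=
      (hg.differentiableAt (isOpen_ball.mem_nhds hfw)).hasFDerivAt
    have hFw : F w = f w := by simp [hF]
    have hFd' : HasFDerivAt F (fderiv ℂ f w + (κ : ℂ) • fderiv ℂ f w) w :=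
      hfd.add ((hfd.sub_const (f w)).const_smul (κ : ℂ))
    have e1 : fderiv ℂ (g ∘ f^[n + 1]) x =
        (fderiv ℂ g (f w)).comp ((fderiv ℂ f w).comp (fderiv ℂ f^[n] x)) := by
      rw [Function.iterate_succ']
      exact (hgd.comp x (hfd.comp x hitd)).fderiv
    have e2 : fderiv ℂ ((g ∘ F) ∘ f^[n]) x =
        ((1 + κ : ℝ) : ℂ) • fderiv ℂ (g ∘ f^[n + 1]) x := by
      have h1 : HasFDerivAt (g ∘ F)
          ((fderiv ℂ g (f w)).comp (fderiv ℂ f w + (κ : ℂ) • fderiv ℂ f w)) w :=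
        HasFDerivAt.comp w (by rw [hFw]; exact hgd) hFd'
      rw [(h1.comp x hitd).fderiv, e1]
      ext v
      simp [add_smul]
    rw [e2, norm_smul, Complex.norm_real, Real.norm_of_nonneg (by linarith)] at key
    calc _ = (1 + κ) ^ n * ((1 + κ) * ‖fderiv ℂ (g ∘ f^[n + 1]) x‖) := by ring
      _ ≤ _ := key

/-- The **Earle–Hamilton fixed point theorem** in a ball: a holomorphic mapping of the ball strictly
inside itself has a unique fixed point, and `1` is in the resolvent set of its derivative there. -/
theorem earleHamilton [CompleteSpace X] {f : X → X} {r η : ℝ} (hr : 0 < r) (hη : 0 < η)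
    (hf : DifferentiableOn ℂ f (ball 0 r))
    (hmap : MapsTo f (ball 0 r) (closedBall 0 (r - η))) :
    (∃! x : X, x ∈ ball 0 r ∧ f x = x) ∧
      ∀ x ∈ ball (0 : X) r, f x = x → IsUnit (1 - fderiv ℂ f x) := by
  have hsub : closedBall (0 : X) (r - η) ⊆ ball 0 r :=
    closedBall_subset_ball (by linarith)
  have hmap' : MapsTo f (ball 0 r) (ball 0 r) := fun y hy => hsub (hmap hy)
  set κ : ℝ := η / (4 * r) with hκ
  have hκ0 : 0 < κ := by positivity
  have hκ1 : 2 * κ * r < η := by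
    rw [hκ]; field_simp; linarith
  have hnd : ∀ k, DifferentiableOn ℂ f^[k] (ball 0 r) := by
    intro k
    induction k with
    | zero => exact differentiableOn_id
    | succ k ihk =>
      rw [Function.iterate_succ']
      exact hf.comp ihk (hmap'.iterate k)
  have hbd : ∀ n, ∀ x ∈ closedBall (0 : X) (r - η),
      (1 + κ) ^ n * ‖fderiv ℂ f^[n] x‖ ≤ 2 * r / η := by
    intro n x hx
    have h1 := norm_fderiv_comp_iterate_le hf hmap hη hκ0.le hκ1 n (g := id) (M := r)
      differentiableOn_id (fun y hy => (mem_ball_zero_iff.1 hy).le) (hsub hx)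
    rw [Function.id_comp] at h1
    refine h1.trans ?_
    rw [mem_closedBall_zero_iff] at hx
    gcongr
    linarith
  -- The derivatives of the iterates decay geometrically, uniformly on the smaller closed ball. This
  -- threshold makes the derivative of the `n`-th iterate at most `1 / 2`, so Banach's theorem
  -- applies to it.
  obtain ⟨n, hn⟩ := pow_unbounded_of_one_lt (4 * r / η) (show 1 < 1 + κ by linarith)
  have hhalf : ∀ x ∈ closedBall (0 : X) (r - η), ‖fderiv ℂ f^[n] x‖ ≤ 1 / 2 := by
    intro x hx
    have h1 := hbd n x hx
    have h2 : 2 * r / η ≤ (1 + κ) ^ n * (1 / 2) := by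
      have : 4 * r / η = 2 * (2 * r / η) := by ring
      linarith
    exact le_of_mul_le_mul_left (h1.trans h2) (by positivity)
  have hnpos : n ≠ 0 := by
    rintro rfl
    have h0 : (0 : ℝ) ≤ r - η :=
      (norm_nonneg _).trans (mem_closedBall_zero_iff.1 (hmap (mem_ball_self hr)))
    rw [pow_zero, div_lt_one hη] at hn
    linarith
  obtain ⟨m, rfl⟩ := Nat.exists_eq_succ_of_ne_zero hnpos
  have hmapn : MapsTo f^[m + 1] (ball 0 r) (closedBall 0 (r - η)) := by
    rw [Function.iterate_succ']
    exact hmap.comp (hmap'.iterate m)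
  have hlip : ∀ x ∈ closedBall (0 : X) (r - η), ∀ y ∈ closedBall (0 : X) (r - η),
      ‖f^[m + 1] y - f^[m + 1] x‖ ≤ 1 / 2 * ‖y - x‖ := fun x hx y hy =>
    (convex_closedBall (0 : X) (r - η)).norm_image_sub_le_of_norm_fderiv_le (𝕜 := ℂ)
      (fun z hz => (hnd _).differentiableAt (isOpen_ball.mem_nhds (hsub hz))) hhalf hx hy
  have hmaps : MapsTo f^[m + 1] (closedBall (0 : X) (r - η)) (closedBall 0 (r - η)) :=
    hmapn.mono_left hsub
  have hcontr : ContractingWith (1 / 2) (hmaps.restrict _ _ _) := by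
    refine ⟨by norm_num, LipschitzWith.of_dist_le_mul fun x y => ?_⟩
    have := hlip y y.2 x x.2
    simpa [Subtype.dist_eq, dist_eq_norm] using this
  have hfixmem : ∀ x ∈ ball (0 : X) r, f x = x → x ∈ closedBall (0 : X) (r - η) :=
    fun x hx h => h ▸ hmap hx
  have huniq : ∀ x ∈ closedBall (0 : X) (r - η), ∀ y ∈ closedBall (0 : X) (r - η),
      f^[m + 1] x = x → f^[m + 1] y = y → x = y := by
    intro x hx y hy h1 h2
    have := hlip y hy x hx
    rw [h1, h2] at this
    have h3 : ‖x - y‖ ≤ 0 := by linarith [norm_nonneg (x - y)]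
    exact sub_eq_zero.1 (norm_le_zero_iff.1 h3)
  constructor
  · obtain ⟨x, hx, hfx, -⟩ := hcontr.exists_fixedPoint' isClosed_closedBall.isComplete hmaps
      (hmap (mem_ball_self hr)) (edist_ne_top _ _)
    refine ⟨x, ⟨hsub hx, ?_⟩, ?_⟩
    -- `f` commutes with its iterate, so `f x` is again a fixed point of the iterate and equals `x`.
    · refine huniq _ (hmap (hsub hx)) _ hx ?_ hfx
      rw [← Function.iterate_succ_apply, Function.iterate_succ_apply', hfx]
    · rintro y ⟨hy, hfy⟩
      exact huniq _ (hfixmem y hy hfy) _ hx (Function.iterate_fixed hfy _) hfx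
  · intro x hx hfx
    have hpow : ∀ k, HasFDerivAt f^[k] ((fderiv ℂ f x) ^ k) x := fun k =>
      (hf.differentiableAt (isOpen_ball.mem_nhds hx)).hasFDerivAt.iterate hfx k
    have h1 : ‖fderiv ℂ f x ^ (m + 1)‖ < 1 := by
      have := hhalf x (hfixmem x hx hfx)
      rw [(hpow (m + 1)).fderiv] at this
      linarith
    have h2 : IsUnit (1 - fderiv ℂ f x ^ (m + 1)) := isUnit_one_sub_of_norm_lt_one h1
    -- `1 - T ^ (m + 1)` is the product of `1 - T` and a geometric sum. These commute, so
    -- invertibility of the product gives that of `1 - T`.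
    have hc : Commute (1 - fderiv ℂ f x) (∑ i ∈ Finset.range (m + 1), fderiv ℂ f x ^ i) :=
      Commute.sum_right _ _ _ fun i _ =>
        ((Commute.one_left _).sub_left ((Commute.refl _).pow_right i))
    rw [← mul_neg_geom_sum] at h2
    exact (hc.isUnit_mul_iff.1 h2).1

end EarleHamilton

/-! ### Duality map and zeros of strictly accretive holomorphic maps. -/

section Zeros

open Metric

theorem norm_of_mem_dualityMap {x : X} {l : X →L[ℂ] ℂ} (hl : l ∈ dualityMap x) : ‖l‖ = ‖x‖ :=
  (pow_left_inj₀ (norm_nonneg _) (norm_nonneg _) two_ne_zero).1 hl.2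

theorem smul_mem_dualityMap {x : X} {l : X →L[ℂ] ℂ} (hl : l ∈ dualityMap x) (ζ : ℂ) :
    (starRingEnd ℂ ζ) • l ∈ dualityMap (ζ • x) := by
  refine ⟨?_, ?_⟩
  · rw [smul_apply, map_smul, hl.1, norm_smul, smul_eq_mul, smul_eq_mul,
      ← mul_assoc, ← Complex.normSq_eq_conj_mul_self, Complex.normSq_eq_norm_sq]
    push_cast; ring
  · rw [norm_smul, norm_smul, norm_of_mem_dualityMap hl, RCLike.norm_conj]

theorem dualityMap_nonempty (x : X) : (dualityMap x).Nonempty := by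
  obtain ⟨g, hg1, hgx⟩ := exists_dual_vector'' ℂ x
  by_cases hx : x = 0
  · subst hx
    exact ⟨0, by simp [dualityMap]⟩
  · have hg : ‖g‖ = 1 := by
      refine le_antisymm hg1 ?_
      have h1 := g.le_opNorm x
      rw [hgx] at h1
      have h2 : 0 < ‖x‖ := norm_pos_iff.2 hx
      have h3 : ‖((‖x‖ : ℝ) : ℂ)‖ = ‖x‖ := by simp
      have h4 : ‖x‖ ≤ ‖g‖ * ‖x‖ := by simpa using h1
      nlinarith
    refine ⟨(‖x‖ : ℂ) • g, ?_, ?_⟩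
    · have : g x = (‖x‖ : ℂ) := hgx
      rw [smul_apply, this, smul_eq_mul]
      push_cast; ring
    · rw [norm_smul, hg]; simp

/-- A bounded holomorphic mapping which is strictly accretive on a sphere has exactly one zero
in the ball, and its derivative is invertible there. -/
theorem existsUnique_zero_of_bounded [CompleteSpace X] {G : X → X} {r r' M δ : ℝ} (hr : 0 < r)
    (hrr' : r < r') (hδ : 0 < δ) (hG : DifferentiableOn ℂ G (ball 0 r'))
    (hM : ∀ x ∈ ball (0 : X) r', ‖G x‖ ≤ M)
    (hacc : ∀ y ∈ sphere (0 : X) r, ∀ l ∈ dualityMap y, δ ≤ (l (G y)).re) :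
    (∃! x : X, x ∈ ball 0 r ∧ G x = 0) ∧
      ∀ x ∈ ball (0 : X) r, G x = 0 → IsUnit (fderiv ℂ G x) := by
  have hM0 : 0 ≤ M := (norm_nonneg _).trans (hM 0 (mem_ball_self (by linarith)))
  obtain ⟨r'', h1, h2⟩ := exists_between hrr'
  set K : ℝ := 2 * M / (r' - r'') with hK
  have hK0 : 0 ≤ K := div_nonneg (by linarith) (by linarith)
  have hlip : ∀ x ∈ closedBall (0 : X) r'', ∀ y ∈ closedBall (0 : X) r'',
      ‖G y - G x‖ ≤ K * ‖y - x‖ := by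
    intro x hx y hy
    have hs : closedBall (0 : X) r'' ⊆ ball 0 r' := closedBall_subset_ball h2
    refine (convex_closedBall (0 : X) r'').norm_image_sub_le_of_norm_fderiv_le (𝕜 := ℂ)
      (fun z hz => hG.differentiableAt (isOpen_ball.mem_nhds (hs hz))) (fun z hz => ?_) hx hy
    have hz' := mem_closedBall_zero_iff.1 hz
    refine (norm_fderiv_le_of_bounded (ρ := r' - ‖z‖) (by linarith)
      (hG.mono (ball_sub_norm_subset z)) fun y hy => hM y (ball_sub_norm_subset z hy)).trans ?_
    rw [hK]
    gcongr
  -- In order: `x - ε G x` stays in the ball where `G` is `K`-Lipschitz; moving by at most `η`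
  -- radially changes `Re l(G ·)` by at most `δ / 4`; the second-order error `r ε² K M` is at most
  -- `ε δ / 4`; and `η ≤ r`, so a point of norm above `r - η` is nonzero.
  obtain ⟨ε, hε, hεM, hεK, hεδ, hεr⟩ : ∃ ε : ℝ, 0 < ε ∧ ε * M ≤ r'' - r ∧ ε * K ≤ 1 ∧
      ε * (4 * r * K * M) ≤ δ ∧ ε * δ ≤ 4 * r * r := by
    have small : ∀ c d : ℝ, 0 < d → ∀ᶠ ε : ℝ in 𝓝[>] 0, ε * c < d := fun c d hd =>
      (((continuous_id.mul continuous_const).tendsto' 0 0 (by simp)).mono_left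
        nhdsWithin_le_nhds).eventually_lt_const hd
    have e0 : ∀ᶠ ε : ℝ in 𝓝[>] 0, 0 < ε := self_mem_nhdsWithin
    obtain ⟨ε, a1, a2, a3, a4, a5⟩ := (e0.and ((small M (r'' - r) (by linarith)).and
      ((small K 1 one_pos).and ((small (4 * r * K * M) δ hδ).and
      (small δ (4 * r * r) (by positivity)))))).exists
    exact ⟨ε, a1, a2.le, a3.le, a4.le, a5.le⟩
  set η : ℝ := ε * δ / (4 * r) with hη
  have hη0 : 0 < η := by positivity
  have hηr : r * η = ε * δ / 4 := by rw [hη]; field_simp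
  set f : X → X := fun x => x - (ε : ℂ) • G x with hf
  have hfd : DifferentiableOn ℂ f (ball 0 r') := by fun_prop
  have hmap : MapsTo f (ball 0 r) (closedBall 0 (r - η)) := by
    intro x hx
    rw [mem_ball_zero_iff] at hx
    rw [mem_closedBall_zero_iff]
    by_contra! hy
    set y := f x with hyx
    have hGx : ‖G x‖ ≤ M := hM x (by rw [mem_ball_zero_iff]; linarith)
    have hnorm : ∀ v : X, ‖(ε : ℂ) • v‖ = ε * ‖v‖ := fun v => by
      rw [norm_smul, Complex.norm_real, Real.norm_of_nonneg hε.le]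
    have hyle : ‖y‖ ≤ r + ε * M := by
      refine (norm_sub_le _ _).trans ?_
      rw [hnorm]; gcongr
    have hyc : y ∈ closedBall (0 : X) r'' := by rw [mem_closedBall_zero_iff]; linarith
    have hxc : x ∈ closedBall (0 : X) r'' := by rw [mem_closedBall_zero_iff]; linarith
    have hypos : 0 < ‖y‖ := by
      have : r * η ≤ r * r := by rw [hηr]; linarith
      linarith [le_of_mul_le_mul_left this hr]
    set t : ℝ := r / ‖y‖ with ht
    have hty : t * ‖y‖ = r := by rw [ht]; field_simp
    have ht0 : 0 < t := by positivity
    set y' : X := (t : ℂ) • y with hy'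
    have hy'n : ‖y'‖ = r := by
      rw [hy', norm_smul, Complex.norm_real, Real.norm_of_nonneg ht0.le, hty]
    obtain ⟨l, hl⟩ := dualityMap_nonempty y'
    have hln : ‖l‖ = r := (norm_of_mem_dualityMap hl).trans hy'n
    have hly : (l y).re = r * ‖y‖ := by
      have h := hl.1
      rw [hy', map_smul, ← hy', hy'n, smul_eq_mul] at h
      have h' : t * (l y).re = r ^ 2 := by
        rw [← Complex.re_ofReal_mul, h, Complex.ofReal_re]
      have : t * (l y).re = t * (r * ‖y‖) := by rw [h', ← hty]; ring
      exact mul_left_cancel₀ ht0.ne' this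
    have hyy' : ‖y - y'‖ = |‖y‖ - r| := by
      have : y - y' = ((1 - t : ℝ) : ℂ) • y := by rw [hy']; push_cast; rw [sub_smul, one_smul]
      rw [this, norm_smul, Complex.norm_real, Real.norm_eq_abs]
      have h0 : ‖y‖ - r = (1 - t) * ‖y‖ := by rw [sub_mul, one_mul, hty]
      rw [h0, abs_mul, abs_norm]
    have hgap : r * (K * ‖y - y'‖) ≤ δ / 4 := by
      have hrK : 0 ≤ r * K := by positivity
      have hd : ‖y - y'‖ ≤ max (ε * M) η := by
        rw [hyy', abs_le]
        constructor
        · linarith [le_max_right (ε * M) η]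
        · linarith [le_max_left (ε * M) η]
      rcases max_choice (ε * M) η with h | h <;> rw [h] at hd
      · have := mul_le_mul_of_nonneg_left hd hrK
        linarith
      · have h1 := mul_le_mul_of_nonneg_left hd hrK
        have h2 : r * K * η = K * (r * η) := by ring
        rw [h2, hηr] at h1
        have h3 := mul_le_mul_of_nonneg_right hεK hδ.le
        linarith
    have hre : ∀ v : X, |(l v).re| ≤ r * ‖v‖ := fun v =>
      (Complex.abs_re_le_norm _).trans (hln ▸ l.le_opNorm v)
    have hy'c : y' ∈ closedBall (0 : X) r'' := by rw [mem_closedBall_zero_iff]; linarith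
    have hGy : δ / 2 ≤ (l (G y)).re := by
      have g1 := hacc y' (by rw [mem_sphere_zero_iff_norm, hy'n]) l hl
      have g2 := (abs_le.1 (hre (G y - G y'))).1
      rw [map_sub, Complex.sub_re] at g2
      have g3 := mul_le_mul_of_nonneg_left (hlip y' hy'c y hyc) hr.le
      linarith
    -- The implicit step `y + ε G y` differs from `x` only by `ε (G y - G x)`, of second order in
    -- `ε`. Accretivity near the sphere gives `Re l(y + ε G y) ≥ r ‖y‖ + ε δ / 2`. Comparing the two
    -- yields `r ‖y‖ ≤ r² - ε δ / 4 = r (r - η)`, the contradiction.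
    have up : ‖y + (ε : ℂ) • G y‖ ≤ r + ε * (K * (ε * M)) := by
      have e1 : y + (ε : ℂ) • G y = x + (ε : ℂ) • (G y - G x) := by
        rw [hyx, hf]; simp only [smul_sub]; abel
      have e2 : ‖y - x‖ ≤ ε * M := by
        have : y - x = -((ε : ℂ) • G x) := by rw [hyx, hf]; simp
        rw [this, norm_neg, hnorm]; gcongr
      rw [e1]
      refine (norm_add_le _ _).trans ?_
      rw [hnorm]
      gcongr
      exact (hlip x hxc y hyc).trans (by gcongr)
    have low := (le_abs_self _).trans (hre (y + (ε : ℂ) • G y))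
    rw [map_add, Complex.add_re, hly, map_smul, smul_eq_mul, Complex.re_ofReal_mul] at low
    have h6 := mul_le_mul_of_nonneg_left hGy hε.le
    have h7 := mul_le_mul_of_nonneg_left up hr.le
    have h8 := mul_le_mul_of_nonneg_left hεδ hε.le
    have h9 := mul_lt_mul_of_pos_left hy hr
    linarith
  have hfix : ∀ x, f x = x ↔ G x = 0 := fun x => by
    simp [hf, hε.ne']
  obtain ⟨hA, hB⟩ := earleHamilton hr hη0 (hfd.mono (ball_subset_ball hrr'.le)) hmap
  refine ⟨by simpa only [hfix] using hA, fun x hx h0 => ?_⟩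
  have h3 := hB x hx ((hfix x).2 h0)
  have h4 : HasFDerivAt G (fderiv ℂ G x) x :=
    (hG.differentiableAt (isOpen_ball.mem_nhds (ball_subset_ball hrr'.le hx))).hasFDerivAt
  have h5 : fderiv ℂ f x = 1 - (ε : ℂ) • fderiv ℂ G x :=
    ((hasFDerivAt_id x).sub (h4.const_smul (ε : ℂ))).fderiv
  rw [h5, sub_sub_cancel] at h3
  have h6 : (ε : ℂ) ≠ 0 := by exact_mod_cast hε.ne'
  have h7 := h3.smul (Units.mk0 (ε : ℂ) h6)⁻¹
  rwa [Units.smul_def, Units.val_inv_eq_inv_val, Units.val_mk0, inv_smul_smul₀ h6] at h7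

end Zeros

/-! ### Continuity of the derivative and local inversion. -/

section Holomorphic

open Metric

theorem exists_ball_norm_le {U : Set X} (hU : IsOpen U) {h : X → X}
    (hh : DifferentiableOn ℂ h U) {x : X} (hx : x ∈ U) :
    ∃ ρ > 0, ball x ρ ⊆ U ∧ ∃ M, ∀ y ∈ ball x ρ, ‖h y‖ ≤ M := by
  have hc : ContinuousAt h x := (hh.differentiableAt (hU.mem_nhds hx)).continuousAt
  have h1 : ∀ᶠ y in 𝓝 x, ‖h y‖ < ‖h x‖ + 1 := hc.norm.eventually_lt_const (by linarith)
  obtain ⟨ρ, hρ, hs⟩ := Metric.eventually_nhds_iff_ball.1 (h1.and (hU.mem_nhds hx))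
  exact ⟨ρ, hρ, fun y hy => (hs y hy).2, _, fun y hy => (hs y hy).1.le⟩

/-- A holomorphic mapping is continuously differentiable. -/
theorem continuousAt_fderiv {U : Set X} (hU : IsOpen U) {h : X → X}
    (hh : DifferentiableOn ℂ h U) {x : X} (hx : x ∈ U) : ContinuousAt (fderiv ℂ h) x := by
  obtain ⟨ρ, hρ, hsub, M, hM⟩ := exists_ball_norm_le hU hh hx
  have hM0 : 0 ≤ M := (norm_nonneg _).trans (hM x (mem_ball_self hρ))
  set K : ℝ := 2 * M / (ρ / 3) with hK
  have hK0 : 0 ≤ K := by positivity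
  have hd : ∀ y ∈ ball x ρ, DifferentiableAt ℂ h y := fun y hy =>
    hh.differentiableAt (hU.mem_nhds (hsub hy))
  have hlip : ∀ y ∈ ball x (2 * ρ / 3), ∀ z ∈ ball x (2 * ρ / 3), ‖h z - h y‖ ≤ K * ‖z - y‖ := by
    intro y hy z hz
    refine (convex_ball x (2 * ρ / 3)).norm_image_sub_le_of_norm_fderiv_le (𝕜 := ℂ)
      (fun w hw => hd w (ball_subset_ball (by linarith) hw)) (fun w hw => ?_) hy hz
    have hs : ball w (ρ / 3) ⊆ ball x ρ := by
      refine ball_subset_ball' ?_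
      rw [mem_ball] at hw; linarith
    exact norm_fderiv_le_of_bounded (by positivity)
      (fun v hv => (hd v (hs hv)).differentiableWithinAt) fun v hv => hM v (hs hv)
  have key : ∀ y ∈ ball x (ρ / 3),
      ‖fderiv ℂ h y - fderiv ℂ h x‖ ≤ 2 * (K * ‖y - x‖) / (ρ / 3) := by
    intro y hy
    have hin : ∀ w ∈ ball x (ρ / 3), w + (y - x) ∈ ball x (2 * ρ / 3) := by
      intro w hw
      rw [mem_ball, dist_eq_norm] at hw hy ⊢
      have : w + (y - x) - x = (w - x) + (y - x) := by abel
      rw [this]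
      linarith [norm_add_le (w - x) (y - x)]
    have hin' : ∀ w ∈ ball x (ρ / 3), w ∈ ball x (2 * ρ / 3) := fun w hw =>
      ball_subset_ball (by linarith) hw
    have hsub' : ball x (2 * ρ / 3) ⊆ ball x ρ := ball_subset_ball (by linarith)
    -- The derivative of this difference at `x` is `h'(y) - h'(x)`. Since `φ` is bounded by `K ‖y -
    -- x‖`, Cauchy's estimate makes `h'` Lipschitz at `x`.
    set φ : X → X := fun w => h (w + (y - x)) - h w with hφ
    have hφd : ∀ w ∈ ball x (ρ / 3),
        HasFDerivAt φ (fderiv ℂ h (w + (y - x)) - fderiv ℂ h w) w := fun w hw =>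
      ((hd _ (hsub' (hin w hw))).hasFDerivAt.comp w
        ((hasFDerivAt_id w).add_const (y - x))).sub (hd _ (hsub' (hin' w hw))).hasFDerivAt
    have hxx : x ∈ ball x (ρ / 3) := mem_ball_self (by positivity)
    have h2 := norm_fderiv_le_of_bounded (c := x) (g := φ) (M := K * ‖y - x‖)
      (ρ := ρ / 3) (by positivity)
      (fun w hw => (hφd w hw).differentiableAt.differentiableWithinAt) fun w hw => by
        have := hlip w (hin' w hw) _ (hin w hw)
        simpa [hφ] using this
    rwa [(hφd x hxx).fderiv, add_sub_cancel] at h2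
  rw [ContinuousAt, tendsto_iff_norm_sub_tendsto_zero]
  refine squeeze_zero' (Eventually.of_forall fun _ => norm_nonneg _)
    (eventually_of_mem (ball_mem_nhds x (by positivity)) key) ?_
  have hc : Continuous fun y : X => 2 * (K * ‖y - x‖) / (ρ / 3) := by fun_prop
  simpa using hc.tendsto x

theorem hasStrictFDerivAt_of_holomorphic {U : Set X} (hU : IsOpen U) {h : X → X}
    (hh : DifferentiableOn ℂ h U) {x : X} (hx : x ∈ U) :
    HasStrictFDerivAt h (fderiv ℂ h x) x :=
  hasStrictFDerivAt_of_hasFDerivAt_of_continuousAt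
    (eventually_of_mem (hU.mem_nhds hx) fun _ hy =>
      (hh.differentiableAt (hU.mem_nhds hy)).hasFDerivAt)
    (continuousAt_fderiv hU hh hx)

/-- An injective holomorphic mapping with invertible derivatives is biholomorphic. -/
theorem isOpen_image_and_differentiableOn_invFunOn [CompleteSpace X] {D : Set X} (hD : IsOpen D)
    {G : X → X} (hG : DifferentiableOn ℂ G D) (hinj : InjOn G D)
    (hunit : ∀ x ∈ D, IsUnit (fderiv ℂ G x)) :
    IsOpen (G '' D) ∧ DifferentiableOn ℂ (Function.invFunOn G D) (G '' D) := by
  have hstrict : ∀ x ∈ D, ∃ e : X ≃L[ℂ] X, HasStrictFDerivAt G (e : X →L[ℂ] X) x := by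
    intro x hx
    obtain ⟨u, hu⟩ := hunit x hx
    refine ⟨ContinuousLinearEquiv.ofUnit u, ?_⟩
    have := hasStrictFDerivAt_of_holomorphic hD hG hx
    rw [← hu] at this
    exact this
  constructor
  · rw [isOpen_iff_mem_nhds]
    rintro _ ⟨x, hx, rfl⟩
    obtain ⟨e, he⟩ := hstrict x hx
    rw [← he.map_nhds_eq_of_equiv]
    exact image_mem_map (hD.mem_nhds hx)
  · rintro _ ⟨x, hx, rfl⟩
    obtain ⟨e, he⟩ := hstrict x hx
    have h1 := he.to_localInverse
    have h2 := he.eventually_right_inverse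
    have h3 : ∀ᶠ z in 𝓝 (G x), he.localInverse G e x z ∈ D := by
      have := h1.continuousAt
      rw [ContinuousAt, he.localInverse_apply_image] at this
      exact this (hD.mem_nhds hx)
    have h4 : Function.invFunOn G D =ᶠ[𝓝 (G x)] he.localInverse G e x := by
      filter_upwards [h2, h3] with z hz2 hz3
      have hz : z ∈ G '' D := ⟨_, hz3, hz2⟩
      exact hinj (Function.invFunOn_mem hz) hz3 ((Function.invFunOn_eq hz).trans hz2.symm)
    exact (h1.hasFDerivAt.congr_of_eventuallyEq h4).differentiableAt.differentiableWithinAt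

end Holomorphic

/-! ### Taylor polynomials at the origin. -/

section Coefficients

open Metric

/-- The homogeneous polynomial of degree `m` in the Taylor expansion of `h` at the origin. -/
def taylorPoly (h : X → X) (m : ℕ) (x : X) : X :=
  (m.factorial : ℂ)⁻¹ • iteratedDeriv m (fun ζ : ℂ => h (ζ • x)) 0

theorem iteratedDeriv_comp_mul_left {E : Type*} [NormedAddCommGroup E] [NormedSpace ℂ E]
    (F : ℂ → E) (a : ℂ) (m : ℕ) :
    iteratedDeriv m (fun ζ => F (a * ζ)) = fun ζ => a ^ m • iteratedDeriv m F (a * ζ) := by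
  induction m with
  | zero => simp
  | succ m ih =>
    funext ζ
    rw [iteratedDeriv_succ, ih, iteratedDeriv_succ, deriv_fun_const_smul_field,
      deriv_comp_mul_left a (iteratedDeriv m F), smul_smul, pow_succ]

theorem taylorPoly_smul (h : X → X) (m : ℕ) (a : ℂ) (x : X) :
    taylorPoly h m (a • x) = a ^ m • taylorPoly h m x := by
  have : (fun ζ : ℂ => h (ζ • a • x)) = fun ζ => (fun ξ : ℂ => h (ξ • x)) (a * ζ) := by
    funext ζ; simp only [smul_smul, mul_comm]
  rw [taylorPoly, this, iteratedDeriv_comp_mul_left (fun ξ : ℂ => h (ξ • x)) a m]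
  simp only [mul_zero]
  rw [taylorPoly, smul_comm]

theorem diffContOnCl_line {h : X → X} {R t : ℝ} (hh : DifferentiableOn ℂ h (ball 0 R)) {x : X}
    (hx : t * ‖x‖ < R) : DiffContOnCl ℂ (fun ζ : ℂ => h (ζ • x)) (ball 0 t) := by
  refine DifferentiableOn.diffContOnCl ?_
  refine hh.comp (by fun_prop) fun ζ hζ => ?_
  have hζ' := mem_closedBall_zero_iff.1 (closure_ball_subset_closedBall hζ)
  rw [mem_ball_zero_iff, norm_smul]
  exact (mul_le_mul_of_nonneg_right hζ' (norm_nonneg _)).trans_lt hx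

theorem taylorPoly_eq_circleIntegral [CompleteSpace X] {h : X → X} {R : ℝ}
    (hh : DifferentiableOn ℂ h (ball 0 R)) (m : ℕ) {x : X} (hx : ‖x‖ < R) :
    taylorPoly h m x = (2 * Real.pi * Complex.I)⁻¹ •
      ∮ ζ in C(0, 1), (1 / ζ ^ (m + 1)) • h (ζ • x) := by
  have hd : DiffContOnCl ℂ (fun ζ : ℂ => h (ζ • x)) (ball 0 1) :=
    diffContOnCl_line hh (by rwa [one_mul])
  have := hd.circleIntegral_one_div_sub_center_pow_smul one_pos m
  simp only [sub_zero] at this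
  rw [this, taylorPoly, smul_smul]
  congr 1
  field_simp [Complex.two_pi_I_ne_zero]

/-- The definition by one-dimensional slices says nothing about dependence on `x`. Cauchy's integral
formula is differentiated under the integral sign, with the bound on `h'` as the dominating
constant. -/
theorem differentiableOn_taylorPoly [CompleteSpace X] {h : X → X} {R M : ℝ}
    (hh : DifferentiableOn ℂ h (ball 0 R)) (hM : ∀ x ∈ ball (0 : X) R, ‖fderiv ℂ h x‖ ≤ M) (m : ℕ) :
    DifferentiableOn ℂ (taylorPoly h m) (ball 0 R) := by
  have hcirc : ∀ (x : X) (θ : ℝ), x ∈ ball (0 : X) R → circleMap 0 1 θ • x ∈ ball (0 : X) R := by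
    intro x θ hx
    simpa [norm_smul] using hx
  have hne : ∀ θ : ℝ, circleMap 0 1 θ ≠ 0 := fun θ => circleMap_ne_center one_ne_zero
  have hcf : ContinuousOn (fderiv ℂ h) (ball 0 R) := fun y hy =>
    (continuousAt_fderiv isOpen_ball hh hy).continuousWithinAt
  have hint : DifferentiableOn ℂ (fun x : X => ∮ ζ in C(0, 1), (1 / ζ ^ (m + 1)) • h (ζ • x))
      (ball 0 R) := by
    intro x₀ hx₀
    set w : ℝ → ℂ := fun θ => deriv (circleMap 0 1) θ * (1 / circleMap 0 1 θ ^ (m + 1)) with hw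
    have hwc : Continuous w := by
      refine Continuous.mul ?_ ?_
      · exact (contDiff_circleMap 0 1 (n := 1)).continuous_deriv le_rfl
      · exact continuous_const.div (by fun_prop) fun θ => pow_ne_zero _ (hne θ)
    have hcont : ∀ x ∈ ball (0 : X) R, Continuous fun θ => w θ • h (circleMap 0 1 θ • x) :=
      fun x hx => hwc.smul (hh.continuousOn.comp_continuous (by fun_prop) fun θ => hcirc x θ hx)
    have key := intervalIntegral.hasFDerivAt_integral_of_dominated_of_fderiv_le (𝕜 := ℂ)
      (μ := MeasureTheory.volume) (a := 0) (b := 2 * Real.pi) (x₀ := x₀) (s := ball 0 R)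
      (bound := fun _ => M)
      (F := fun x θ => w θ • h (circleMap 0 1 θ • x))
      (F' := fun x θ => w θ • (circleMap 0 1 θ • fderiv ℂ h (circleMap 0 1 θ • x)))
      (isOpen_ball.mem_nhds hx₀)
      (eventually_of_mem (isOpen_ball.mem_nhds hx₀) fun x hx => (hcont x hx).aestronglyMeasurable)
      ((hcont x₀ hx₀).intervalIntegrable _ _)
      (by
        refine Continuous.aestronglyMeasurable ?_
        refine hwc.smul ((continuous_circleMap 0 1).smul ?_)
        exact hcf.comp_continuous (by fun_prop) fun θ => hcirc x₀ θ hx₀)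
      (Eventually.of_forall fun θ _ x hx => by
        have := hM _ (hcirc x θ hx)
        simpa [norm_smul, hw] using this)
      intervalIntegrable_const
      (Eventually.of_forall fun θ _ x hx => by
        have h1 : HasFDerivAt h (fderiv ℂ h (circleMap 0 1 θ • x)) (circleMap 0 1 θ • x) :=
          (hh.differentiableAt (isOpen_ball.mem_nhds (hcirc x θ hx))).hasFDerivAt
        have h2 := h1.comp x ((hasFDerivAt_id x).const_smul (circleMap 0 1 θ))
        have h3 := h2.const_smul (w θ)
        refine h3.congr_fderiv ?_
        ext v
        simp)
    have := key.differentiableAt.differentiableWithinAt (s := ball 0 R)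
    refine this.congr (fun x _ => ?_) ?_ <;>
    simp [circleIntegral, hw, smul_smul]
  refine (hint.const_smul (2 * Real.pi * Complex.I)⁻¹).congr fun x hx => ?_
  exact taylorPoly_eq_circleIntegral hh m (mem_ball_zero_iff.1 hx)

end Coefficients

/-! ### Harris' inequality and boundedness from the numerical range. -/

section NumericalRadius

open Metric

/-- Harris' comparison of the norm and the numerical radius of a homogeneous polynomial. -/
theorem norm_le_of_numericalRadius_le [CompleteSpace X] {P : X → X} {m : ℕ} (hm : 2 ≤ m)
    (hP : Differentiable ℂ P) (hom : ∀ (a : ℂ) (x : X), P (a • x) = a ^ m • P x) {M : ℝ}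
    (hM : ∀ x, ‖P x‖ ≤ M * ‖x‖ ^ m) {v : ℝ} (hv : 0 < v)
    (hnum : ∀ u ∈ sphere (0 : X) 1, ∀ l ∈ dualityMap u, ‖l (P u)‖ ≤ v)
    {u : X} (hu : u ∈ sphere (0 : X) 1) : ‖P u‖ ≤ 4 * m ^ 2 * v := by
  have hM0 : 0 ≤ M := by
    have := (norm_nonneg _).trans (hM u)
    rw [mem_sphere_zero_iff_norm] at hu
    simpa [hu] using this
  have hm0 : (2 : ℝ) ≤ m := by exact_mod_cast hm
  -- With `a v = 1 / m²`, the map `x - a P x - z` is accretive on the unit sphere with constant `ρ -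
  -- ‖z‖`, so `G` has a holomorphic inverse `Φ` from the `ρ`-ball into the unit ball. Bernoulli's
  -- inequality keeps `ρ ^ m ≥ 1 / 2`; this choice produces the factor `4 m²`.
  set a : ℝ := 1 / (m ^ 2 * v) with ha
  have ha0 : 0 < a := by positivity
  have hav : a * v = 1 / (m : ℝ) ^ 2 := by rw [ha]; field_simp
  set ρ : ℝ := 1 - 1 / (m : ℝ) ^ 2 with hρ
  have hρ0 : 0 < ρ := by
    have : 1 / (m : ℝ) ^ 2 < 1 := by
      rw [div_lt_one (by positivity)]; nlinarith
    linarith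
  have hρm : 1 / 2 ≤ ρ ^ m := by
    have h1 : -2 ≤ -(1 / (m : ℝ) ^ 2) := by
      have : 1 / (m : ℝ) ^ 2 ≤ 1 := by
        rw [div_le_one (by positivity)]; nlinarith
      linarith
    have h2 := one_add_mul_le_pow h1 m
    have h3 : (m : ℝ) * -(1 / (m : ℝ) ^ 2) = -(1 / m) := by field_simp
    have h4 : 1 / (m : ℝ) ≤ 1 / 2 := one_div_le_one_div_of_le (by norm_num) hm0
    rw [h3] at h2
    have h5 : 1 + -(1 / (m : ℝ) ^ 2) = ρ := by rw [hρ]; ring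
    rw [h5] at h2
    linarith
  set G : X → X := fun x => x - (a : ℂ) • P x with hG
  have hGd : Differentiable ℂ G := by fun_prop
  have hsolve : ∀ z : X, ‖z‖ < ρ →
      (∃! x : X, x ∈ ball 0 1 ∧ G x - z = 0) ∧
        ∀ x ∈ ball (0 : X) 1, G x - z = 0 → IsUnit (fderiv ℂ (fun y => G y - z) x) := by
    intro z hz
    refine existsUnique_zero_of_bounded (r' := 2) (M := 2 + a * (M * 2 ^ m) + ρ)
      (δ := ρ - ‖z‖) one_pos one_lt_two (by linarith) (by fun_prop) ?_ ?_
    · intro x hx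
      rw [mem_ball_zero_iff] at hx
      have h1 : ‖(a : ℂ) • P x‖ ≤ a * (M * 2 ^ m) := by
        rw [norm_smul, Complex.norm_real, Real.norm_of_nonneg ha0.le]
        gcongr
        exact (hM x).trans (by gcongr)
      calc ‖G x - z‖ ≤ ‖G x‖ + ‖z‖ := norm_sub_le _ _
        _ ≤ (‖x‖ + ‖(a : ℂ) • P x‖) + ‖z‖ := by gcongr; exact norm_sub_le _ _
        _ ≤ _ := by gcongr
    · intro y hy l hl
      have hy1 : ‖y‖ = 1 := by simpa using hy
      have h1 : (l y).re = 1 := by rw [hl.1, hy1]; simp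
      have h2 : (l (P y)).re ≤ v := (Complex.re_le_norm _).trans (hnum y hy l hl)
      have h3 : (l z).re ≤ ‖z‖ := by
        refine (Complex.re_le_norm _).trans ((l.le_opNorm z).trans_eq ?_)
        rw [norm_of_mem_dualityMap hl, hy1, one_mul]
      have h4 := mul_le_mul_of_nonneg_left h2 ha0.le
      simp only [hG, map_sub, map_smul, Complex.sub_re, smul_eq_mul, Complex.re_ofReal_mul, h1]
      linarith
  set D : Set X := {x | x ∈ ball (0 : X) 1 ∧ G x ∈ ball (0 : X) ρ} with hD
  have hDo : IsOpen D := isOpen_ball.inter (isOpen_ball.preimage hGd.continuous)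
  have hinj : InjOn G D := by
    intro x hx y hy hxy
    exact (hsolve (G x) (by simpa using hx.2)).1.unique ⟨hx.1, sub_self _⟩
      ⟨hy.1, by rw [hxy, sub_self]⟩
  have hunit : ∀ x ∈ D, IsUnit (fderiv ℂ G x) := by
    intro x hx
    have := (hsolve (G x) (by simpa using hx.2)).2 x hx.1 (sub_self _)
    rwa [fderiv_sub_const] at this
  have himg : G '' D = ball 0 ρ := by
    refine Subset.antisymm (by rintro _ ⟨x, hx, rfl⟩; exact hx.2) fun z hz => ?_
    obtain ⟨x, ⟨hx, hxz⟩, -⟩ := (hsolve z (by simpa using hz)).1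
    rw [sub_eq_zero] at hxz
    exact ⟨x, ⟨hx, hxz ▸ hz⟩, hxz⟩
  obtain ⟨-, hΦd⟩ := isOpen_image_and_differentiableOn_invFunOn hDo hGd.differentiableOn hinj hunit
  rw [himg] at hΦd
  set Φ := Function.invFunOn G D with hΦ
  have hΦG : ∀ x ∈ D, Φ (G x) = x := fun x hx => hinj.leftInvOn_invFunOn hx
  have hΦmem : ∀ z ∈ ball (0 : X) ρ, Φ z ∈ D ∧ G (Φ z) = z := by
    intro z hz
    rw [← himg] at hz
    exact ⟨Function.invFunOn_mem hz, Function.invFunOn_eq hz⟩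
  have hP0 : P 0 = 0 := by
    have := hom 0 0
    simpa [show m ≠ 0 by omega] using this
  have hG0 : G 0 = 0 := by simp [hG, hP0]
  have h0D : (0 : X) ∈ D := ⟨mem_ball_self one_pos, by rw [hG0]; exact mem_ball_self hρ0⟩
  have hΦ0 : Φ 0 = 0 := by
    have := hΦG 0 h0D
    rwa [hG0] at this
  have hdiff : ∀ z ∈ ball (0 : X) ρ, Φ z - z = (a : ℂ) • P (Φ z) := by
    intro z hz
    have := (hΦmem z hz).2
    nth_rw 2 [← this]
    simp [hG]
  -- `Φ z - z = a P(Φ z)` vanishes to order `m` at the origin. The Schwarz lemma below takes `o(‖z‖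
  -- ^ (m - 1))` as input and returns the exponent `m`.
  have hlo : (fun z => (Φ z - z) - (Φ 0 - 0)) =o[𝓝 0] fun z : X => ‖z - 0‖ ^ (m - 1) := by
    have h1 : (fun z => (Φ z - z) - (Φ 0 - 0)) =ᶠ[𝓝 0] fun z => (a : ℂ) • P (Φ z) := by
      filter_upwards [ball_mem_nhds (0 : X) hρ0] with z hz
      rw [hdiff z hz, hΦ0]; simp
    have h2 : (fun z => Φ z) =O[𝓝 0] fun z : X => ‖z‖ := by
      have := (hΦd.differentiableAt (ball_mem_nhds (0 : X) hρ0)).isBigO_sub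
      simpa [hΦ0] using this.norm_right
    have h3 : (fun z => (a : ℂ) • P (Φ z)) =O[𝓝 0] fun z : X => ‖z‖ ^ m := by
      refine Asymptotics.IsBigO.trans ?_ (h2.norm_left.pow m)
      refine Asymptotics.IsBigO.of_bound (a * M) (Eventually.of_forall fun z => ?_)
      rw [norm_smul, Complex.norm_real, Real.norm_of_nonneg ha0.le, norm_pow, norm_norm, mul_assoc]
      gcongr
      exact hM _
    refine (h3.trans_isLittleO ?_).congr' h1.symm EventuallyEq.rfl
    have h4 : (fun z : X => ‖z‖ ^ m) = fun z => ‖z‖ ^ (m - 1) * ‖z‖ := by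
      funext z; rw [← pow_succ]; congr 1; omega
    rw [h4]
    have h5 : (fun z : X => ‖z‖) =o[𝓝 0] fun _ => (1 : ℝ) :=
      (Asymptotics.isLittleO_one_iff ℝ).2 (by simpa using (continuous_norm (E := X)).tendsto 0)
    simpa using (Asymptotics.isBigO_refl (fun z : X => ‖z‖ ^ (m - 1)) (𝓝 0)).mul_isLittleO h5
  have hsch : ∀ z ∈ ball (0 : X) ρ, ‖Φ z - z‖ ≤ 2 * (‖z‖ / ρ) ^ m := by
    intro z hz
    have := Complex.dist_le_mul_div_pow_of_mapsTo_ball_of_isLittleO (f := fun z => Φ z - z)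
      (c := (0 : X)) (R₁ := ρ) (R₂ := 2) (n := m - 1) (by fun_prop) (fun w hw => ?_) hlo hz
    · rw [show m - 1 + 1 = m by omega] at this
      simpa [hΦ0] using this
    · simp only [hΦ0, sub_zero, mem_closedBall_zero_iff]
      have h1 := mem_ball_zero_iff.1 (hΦmem w hw).1.1
      have h2 := mem_ball_zero_iff.1 hw
      have h3 : ρ ≤ 1 := by rw [hρ]; linarith [show 0 ≤ 1 / (m : ℝ) ^ 2 by positivity]
      linarith [norm_sub_le (Φ w) w]
  -- compare along `ε • u` as `ε → 0`
  have hlim : Tendsto (fun ε : ℝ => 2 * (‖u - ((a * ε ^ (m - 1) : ℝ) : ℂ) • P u‖ / ρ) ^ m)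
      (𝓝[>] 0) (𝓝 (2 * (‖u‖ / ρ) ^ m)) := by
    have hc : Continuous fun ε : ℝ => 2 * (‖u - ((a * ε ^ (m - 1) : ℝ) : ℂ) • P u‖ / ρ) ^ m := by
      fun_prop
    refine (hc.tendsto' 0 _ ?_).mono_left nhdsWithin_le_nhds
    simp [show m - 1 ≠ 0 by omega]
  have hev : ∀ᶠ ε : ℝ in 𝓝[>] 0,
      a * ‖P u‖ ≤ 2 * (‖u - ((a * ε ^ (m - 1) : ℝ) : ℂ) • P u‖ / ρ) ^ m := by
    have e1 : ∀ᶠ ε : ℝ in 𝓝[>] 0, ((ε : ℂ) • u) ∈ D := by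
      have hc : Continuous fun ε : ℝ => (ε : ℂ) • u := by fun_prop
      exact ((hc.tendsto' 0 0 (by simp)).mono_left nhdsWithin_le_nhds) (hDo.mem_nhds h0D)
    filter_upwards [e1, self_mem_nhdsWithin] with ε hε hεpos
    have hεpos : 0 < ε := hεpos
    have hGε : G ((ε : ℂ) • u) = (ε : ℂ) • (u - ((a * ε ^ (m - 1) : ℝ) : ℂ) • P u) := by
      simp only [hG, hom, smul_sub, smul_smul]
      congr 2
      have : (ε : ℂ) ^ m = ε * ε ^ (m - 1) := by rw [← pow_succ']; congr 1; omega
      rw [this]; push_cast; ring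
    have h1 := hsch _ hε.2
    rw [hdiff _ hε.2, hΦG _ hε, hGε, hom, smul_smul, norm_smul, norm_smul, norm_mul, norm_pow,
      Complex.norm_real, Complex.norm_real, Real.norm_of_nonneg ha0.le,
      Real.norm_of_nonneg hεpos.le, mul_div_assoc, mul_pow] at h1
    have h2 : 0 < ε ^ m := by positivity
    refine le_of_mul_le_mul_left ?_ h2
    calc _ = a * ε ^ m * ‖P u‖ := by ring
      _ ≤ _ := h1
      _ = _ := by ring
  have hfin := ge_of_tendsto hlim hev
  rw [mem_sphere_zero_iff_norm] at hu
  rw [hu, div_pow, one_pow] at hfin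
  have h6 : 2 * (1 / ρ ^ m) ≤ 4 := by
    rw [mul_one_div, div_le_iff₀ (by positivity)]; linarith
  have h7 : a * ‖P u‖ ≤ 4 := hfin.trans h6
  rw [ha, one_div_mul_eq_div, div_le_iff₀ (by positivity)] at h7
  linarith

/-- A holomorphic mapping with bounded numerical range is bounded on smaller balls. -/
theorem exists_norm_le_of_numericalRange_bounded [CompleteSpace X] {h : X → X} {R s r C : ℝ}
    (hh : DifferentiableOn ℂ h (ball 0 R)) (hr : 0 < r) (hrs : r < s) (hsR : s < R) (hC : 0 < C)
    (hnum : ∀ u ∈ sphere (0 : X) 1, ∀ l ∈ dualityMap u, ∀ ζ : ℂ, ‖ζ‖ ≤ s → ‖l (h (ζ • u))‖ ≤ C) :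
    ∃ M, ∀ x ∈ ball (0 : X) r, ‖h x‖ ≤ M := by
  have hs : 0 < s := hr.trans hrs
  obtain ⟨ρ, hρ, hsub, M, hM⟩ := exists_ball_norm_le isOpen_ball hh
    (mem_ball_self (x := (0 : X)) (hs.trans hsR))
  have hM0 : 0 ≤ M := (norm_nonneg _).trans (hM 0 (mem_ball_self hρ))
  have hPd : ∀ m, Differentiable ℂ (taylorPoly h m) := by
    intro m x
    have hfd : ∀ y ∈ ball (0 : X) (ρ / 2), ‖fderiv ℂ h y‖ ≤ 2 * M / (ρ / 2) := by
      intro y hy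
      have hs : ball y (ρ / 2) ⊆ ball 0 ρ := by
        refine ball_subset_ball' ?_
        rw [mem_ball] at hy; linarith
      exact norm_fderiv_le_of_bounded (by positivity) (hh.mono (hs.trans hsub))
        fun v hv => hM v (hs hv)
    have hdb := differentiableOn_taylorPoly (hh.mono ((ball_subset_ball (by linarith)).trans hsub))
      hfd m
    -- Near the origin `h` has a bounded derivative, so the polynomial is differentiable there;
    -- homogeneity spreads this to all of `X`.
    obtain ⟨ε, hε, hεx⟩ : ∃ ε : ℝ, 0 < ε ∧ (ε : ℂ) • x ∈ ball (0 : X) (ρ / 2) := by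
      have hc : Continuous fun ε : ℝ => (ε : ℂ) • x := by fun_prop
      have h1 : ∀ᶠ ε : ℝ in 𝓝[>] 0, (ε : ℂ) • x ∈ ball (0 : X) (ρ / 2) :=
        ((hc.tendsto' 0 0 (by simp)).mono_left nhdsWithin_le_nhds)
          (ball_mem_nhds (0 : X) (by positivity))
      have h2 : ∀ᶠ ε : ℝ in 𝓝[>] 0, 0 < ε := self_mem_nhdsWithin
      exact (h2.and h1).exists
    have hε' : (ε : ℂ) ≠ 0 := by exact_mod_cast hε.ne'
    have h3 : taylorPoly h m = fun y => ((ε : ℂ) ^ m)⁻¹ • taylorPoly h m ((ε : ℂ) • y) := by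
      funext y
      rw [taylorPoly_smul, inv_smul_smul₀ (pow_ne_zero _ hε')]
    rw [h3]
    have h4 : DifferentiableAt ℂ (taylorPoly h m) ((ε : ℂ) • x) :=
      hdb.differentiableAt (isOpen_ball.mem_nhds hεx)
    exact (h4.comp x (differentiableAt_id.const_smul (ε : ℂ))).const_smul _
  have hPM : ∀ m x, ‖taylorPoly h m x‖ ≤ M * (2 / ρ) ^ m * ‖x‖ ^ m := by
    intro m x
    rcases eq_or_ne x 0 with rfl | hx
    · rcases eq_or_ne m 0 with rfl | hm
      · simpa [taylorPoly] using hM 0 (mem_ball_self hρ)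
      · have := taylorPoly_smul h m 0 0
        rw [smul_zero, zero_pow hm, zero_smul] at this
        simp [this, hm]
    · have hx' : 0 < ‖x‖ := norm_pos_iff.2 hx
      set t : ℝ := ρ / 2 / ‖x‖ with ht
      have htx : t * ‖x‖ = ρ / 2 := by rw [ht]; field_simp
      have ht0 : 0 < t := by positivity
      have h1 := Complex.norm_iteratedDeriv_le_of_forall_mem_sphere_norm_le m ht0 (C := M)
        (diffContOnCl_line (hh.mono hsub) (by linarith : t * ‖x‖ < ρ)) fun ζ hζ => by
          refine hM _ ?_
          rw [mem_ball_zero_iff, norm_smul, mem_sphere_zero_iff_norm.1 hζ]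
          linarith
      rw [taylorPoly, norm_smul, norm_inv, Complex.norm_natCast, inv_mul_le_iff₀ (by positivity)]
      refine h1.trans_eq ?_
      rw [ht]
      simp only [div_pow]
      field_simp
  have hPnum : ∀ m, ∀ u ∈ sphere (0 : X) 1, ∀ l ∈ dualityMap u,
      ‖l (taylorPoly h m u)‖ ≤ C / s ^ m := by
    intro m u hu l hl
    have hu1 : ‖u‖ = 1 := mem_sphere_zero_iff_norm.1 hu
    have hd := diffContOnCl_line (t := s) hh (x := u) (by rwa [hu1, mul_one])
    have h1 := Complex.norm_iteratedDeriv_le_of_forall_mem_sphere_norm_le m hs (C := C)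
      (l.differentiable.comp_diffContOnCl hd) fun ζ hζ =>
        hnum u hu l hl ζ (mem_sphere_zero_iff_norm.1 hζ).le
    have h2 : iteratedDeriv m (l ∘ fun ζ : ℂ => h (ζ • u)) 0 =
        l (iteratedDeriv m (fun ζ : ℂ => h (ζ • u)) 0) := by
      have hc : ContDiffAt ℂ m (fun ζ : ℂ => h (ζ • u)) 0 :=
        (hd.differentiableOn.analyticAt (ball_mem_nhds 0 hs)).contDiffAt
      rw [iteratedDeriv_eq_iteratedFDeriv, l.iteratedFDeriv_comp_left hc le_rfl,
        iteratedDeriv_eq_iteratedFDeriv]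
      rfl
    rw [h2] at h1
    rw [taylorPoly, map_smul, norm_smul, norm_inv, Complex.norm_natCast,
      inv_mul_le_iff₀ (by positivity), ← mul_div_assoc]
    exact h1
  -- Harris' inequality needs degree at least `2`; degrees `0` and `1` are bounded by Cauchy's
  -- estimate on a small ball where `h` is bounded.
  set b : ℕ → ℝ := fun m => if m < 2 then M * (2 / ρ) ^ m * r ^ m else 4 * C * (m ^ 2 * (r / s) ^ m)
    with hb
  have hbs : Summable b := by
    rw [← summable_nat_add_iff 2]
    have h1 : (fun m => b (m + 2)) =
        fun m => 4 * C * (((m + 2 : ℕ) : ℝ) ^ 2 * (r / s) ^ (m + 2)) := by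
      funext m; simp [hb]
    rw [h1]
    have h2 : Summable fun m : ℕ => (m : ℝ) ^ 2 * (r / s) ^ m :=
      summable_pow_mul_geometric_of_norm_lt_one 2
        (by rw [Real.norm_of_nonneg (by positivity), div_lt_one hs]; exact hrs)
    exact ((summable_nat_add_iff 2).2 h2).mul_left (4 * C)
  refine ⟨∑' m, b m, fun x hx => ?_⟩
  rw [mem_ball_zero_iff] at hx
  have hsum : HasSum (fun m => taylorPoly h m x) (h x) := by
    obtain ⟨t, ht1, htx⟩ : ∃ t : ℝ, 1 < t ∧ t * ‖x‖ < R := by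
      have hc : Continuous fun t : ℝ => t * ‖x‖ := by fun_prop
      have h1 : ∀ᶠ t : ℝ in 𝓝[>] 1, t * ‖x‖ < R :=
        ((hc.tendsto 1).mono_left nhdsWithin_le_nhds).eventually_lt_const (by linarith)
      have h2 : ∀ᶠ t : ℝ in 𝓝[>] 1, 1 < t := self_mem_nhdsWithin
      exact (h2.and h1).exists
    have h3 := Complex.hasSum_taylorSeries_on_ball (diffContOnCl_line hh htx).differentiableOn
      (z := 1) (by simpa using ht1)
    simpa [taylorPoly] using h3
  refine hsum.norm_le_of_bounded hbs.hasSum fun m => ?_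
  by_cases hm : m < 2
  · simp only [hb, hm, if_true]
    exact (hPM m x).trans (by gcongr)
  · simp only [hb, hm, if_false]
    push Not at hm
    rcases eq_or_ne x 0 with rfl | hx0
    · refine (hPM m 0).trans ?_
      rw [norm_zero, zero_pow (by omega), mul_zero]
      positivity
    · have hx' : 0 < ‖x‖ := norm_pos_iff.2 hx0
      have hxC : (‖x‖ : ℂ) ≠ 0 := by exact_mod_cast hx'.ne'
      set u : X := (‖x‖ : ℂ)⁻¹ • x with hu
      have hxu : x = (‖x‖ : ℂ) • u := by rw [hu, smul_inv_smul₀ hxC]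
      have hu1 : u ∈ sphere (0 : X) 1 := by
        rw [mem_sphere_zero_iff_norm, hu, norm_smul, norm_inv, Complex.norm_real, norm_norm,
          inv_mul_cancel₀ hx'.ne']
      have h4 := norm_le_of_numericalRadius_le hm (hPd m) (taylorPoly_smul h m) (hPM m)
        (v := C / s ^ m) (by positivity) (hPnum m) hu1
      rw [hxu, taylorPoly_smul, norm_smul, norm_pow, Complex.norm_real, norm_norm]
      calc ‖x‖ ^ m * ‖taylorPoly h m u‖ ≤ r ^ m * (4 * m ^ 2 * (C / s ^ m)) := by gcongr
        _ = _ := by rw [div_pow]; ring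

end NumericalRadius

/-! ### Growth estimates from a one-sided bound on a sphere. -/

section Growth

open Metric InnerProductSpace ComplexConjugate

/-- **Harnack's inequality** (lower bound) in a disc. -/
theorem harnack_lower {u : ℂ → ℝ} {s : ℝ} (hu : HarmonicOnNhd u (closedBall 0 s))
    (hnn : ∀ z ∈ sphere (0 : ℂ) s, 0 ≤ u z) {w : ℂ} (hw : w ∈ ball (0 : ℂ) s) :
    (s - ‖w‖) / (s + ‖w‖) * u 0 ≤ u w := by
  have hs : 0 < s := pos_of_mem_ball hw
  have h1 := hu.circleAverage_re_herglotzRieszKernel_smul hw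
  have h2 : Real.circleAverage u 0 s = u 0 :=
    InnerProductSpace.HarmonicOnNhd.circleAverage_eq (by rwa [abs_of_pos hs])
  have huc : ContinuousOn u (sphere 0 s) := hu.continuousOn.mono sphere_subset_closedBall
  have hkc : ContinuousOn (Complex.re ∘ herglotzRieszKernel 0 w) (sphere 0 s) :=
    Complex.continuous_re.comp_continuousOn
      (by simpa only [abs_of_pos hs] using continuousOn_herglotzRieszKernel_sphere hw)
  rw [← h1, ← h2, ← smul_eq_mul, ← Real.circleAverage_smul]
  refine Real.circleAverage_mono ?_ ?_ fun z hz => ?_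
  · exact (huc.const_smul ((s - ‖w‖) / (s + ‖w‖))).circleIntegrable hs.le
  · exact (hkc.smul huc).circleIntegrable hs.le
  · rw [abs_of_pos hs] at hz
    have := le_re_herglotzRieszKernel hz hw
    simp only [sub_zero] at this
    simp only [Pi.smul_apply, Pi.smul_apply', smul_eq_mul, Function.comp_apply,
      herglotzRieszKernel_def, sub_zero]
    exact mul_le_mul_of_nonneg_right this (hnn z hz)

/-! ### Scalar functions in a disc. -/

section Disc

variable {p : ℂ → ℂ} {R s B : ℝ}

theorem harmonicOnNhd_sub_re (hp : DifferentiableOn ℂ p (ball 0 R)) (hsR : s < R) :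
    HarmonicOnNhd (fun z => B - (p z).re) (closedBall 0 s) := by
  intro z hz
  have hz' : z ∈ ball (0 : ℂ) R := closedBall_subset_ball hsR hz
  have := ((differentiableOn_const (B : ℂ)).sub hp).analyticAt (isOpen_ball.mem_nhds hz')
  simpa using this.harmonicAt_re

/-- Harnack's lower bound for the harmonic function `B - Re p`, nonnegative on the circle. -/
theorem re_le_of_re_le_sphere (hp : DifferentiableOn ℂ p (ball 0 R)) (hsR : s < R)
    (hB : ∀ z ∈ sphere (0 : ℂ) s, (p z).re ≤ B) {w : ℂ} (hw : w ∈ ball (0 : ℂ) s) :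
    (p w).re ≤ (s - ‖w‖) / (s + ‖w‖) * (p 0).re + 2 * ‖w‖ / (s + ‖w‖) * B := by
  have hs : 0 < s := pos_of_mem_ball hw
  have := harnack_lower (harmonicOnNhd_sub_re (B := B) hp hsR)
    (fun z hz => sub_nonneg.2 (hB z hz)) hw
  have h0 : 0 ≤ ‖w‖ := norm_nonneg w
  have e : 2 * ‖w‖ / (s + ‖w‖) = 1 - (s - ‖w‖) / (s + ‖w‖) := by field_simp; ring
  rw [e]
  linarith

theorem re_zero_le_of_re_le_sphere (hp : DifferentiableOn ℂ p (ball 0 R)) (hs : 0 < s)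
    (hsR : s < R) (hB : ∀ z ∈ sphere (0 : ℂ) s, (p z).re ≤ B) : (p 0).re ≤ B := by
  have hu := harmonicOnNhd_sub_re (B := B) hp hsR
  have h2 : Real.circleAverage (fun z => B - (p z).re) 0 s = B - (p 0).re :=
    InnerProductSpace.HarmonicOnNhd.circleAverage_eq (by rwa [abs_of_pos hs])
  have := Real.circleAverage_nonneg_of_nonneg (c := 0) (R := s) (f := fun z => B - (p z).re)
    (fun z hz => sub_nonneg.2 (hB z (by rwa [abs_of_pos hs] at hz)))
  linarith

/-- The auxiliary function whose real part on `‖ζ‖ = s` is `Re (conj ζ * g ζ) / s ^ 2`. -/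
def symmQuot (g : ℂ → ℂ) (s : ℝ) (ζ : ℂ) : ℂ := dslope g 0 ζ + conj (g 0) * ζ / (s : ℂ) ^ 2

variable {g : ℂ → ℂ}

theorem differentiableOn_symmQuot (hg : DifferentiableOn ℂ g (ball 0 R)) (hR : 0 < R) :
    DifferentiableOn ℂ (symmQuot g s) (ball 0 R) := by
  have := (Complex.differentiableOn_dslope (ball_mem_nhds (0 : ℂ) hR)).2 hg
  unfold symmQuot
  fun_prop

theorem symmQuot_zero (g : ℂ → ℂ) (s : ℝ) : symmQuot g s 0 = deriv g 0 := by simp [symmQuot]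

/-- Since `Re(conj(g 0) ζ) = Re(conj ζ · g 0)`, the linear correction in `symmQuot` cancels the
constant term exactly on `‖ζ‖ = s`; inside, the remainder carries the factor `1 - ‖ζ‖² / s²`, which
becomes the `‖h 0‖` term of `ω`. -/
theorem re_conj_mul_eq (g : ℂ → ℂ) {s : ℝ} (hs : s ≠ 0) (ζ : ℂ) :
    (conj ζ * g ζ).re = (conj ζ * g 0).re * (1 - ‖ζ‖ ^ 2 / s ^ 2) +
      ‖ζ‖ ^ 2 * (symmQuot g s ζ).re := by
  have h1 : g ζ = g 0 + ζ * dslope g 0 ζ := by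
    have := sub_smul_dslope g 0 ζ
    rw [sub_zero, smul_eq_mul] at this
    rw [this]; ring
  have h2 : conj ζ * g ζ = conj ζ * g 0 + ((‖ζ‖ ^ 2 : ℝ) : ℂ) * dslope g 0 ζ := by
    rw [h1, mul_add, ← mul_assoc, ← Complex.normSq_eq_conj_mul_self, Complex.normSq_eq_norm_sq]
  have h3 : (conj (g 0) * ζ / (s : ℂ) ^ 2).re = (conj ζ * g 0).re / s ^ 2 := by
    rw [← Complex.ofReal_pow, Complex.div_ofReal_re]
    congr 1
    simp [Complex.mul_re]
    ring
  rw [h2, Complex.add_re, Complex.re_ofReal_mul, symmQuot, Complex.add_re, h3]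
  field_simp
  ring

theorem re_symmQuot_le_sphere (hs : 0 < s)
    (hB : ∀ ζ ∈ sphere (0 : ℂ) s, (conj ζ * g ζ).re ≤ s ^ 2 * B) :
    ∀ ζ ∈ sphere (0 : ℂ) s, (symmQuot g s ζ).re ≤ B := by
  intro ζ hζ
  have h := hB ζ hζ
  rw [re_conj_mul_eq g hs.ne' ζ, mem_sphere_zero_iff_norm.1 hζ, div_self (by positivity)] at h
  rw [sub_self, mul_zero, zero_add] at h
  exact le_of_mul_le_mul_left h (by positivity)

theorem re_conj_mul_le (hg : DifferentiableOn ℂ g (ball 0 R)) (hsR : s < R)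
    (hB : ∀ ζ ∈ sphere (0 : ℂ) s, (conj ζ * g ζ).re ≤ s ^ 2 * B) {ζ : ℂ} (hζ : ‖ζ‖ < s) :
    (conj ζ * g ζ).re ≤ ‖ζ‖ * ‖g 0‖ * (1 - ‖ζ‖ ^ 2 / s ^ 2) +
      ‖ζ‖ ^ 2 * ((s - ‖ζ‖) / (s + ‖ζ‖) * (deriv g 0).re + 2 * ‖ζ‖ / (s + ‖ζ‖) * B) := by
  have hs : 0 < s := (norm_nonneg _).trans_lt hζ
  rw [re_conj_mul_eq g hs.ne' ζ]
  have h1 := re_le_of_re_le_sphere (differentiableOn_symmQuot hg (hs.trans hsR)) hsR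
    (re_symmQuot_le_sphere hs hB) (mem_ball_zero_iff.2 hζ)
  rw [symmQuot_zero] at h1
  have h2 : (conj ζ * g 0).re ≤ ‖ζ‖ * ‖g 0‖ := by
    refine (Complex.re_le_norm _).trans_eq ?_
    rw [norm_mul, RCLike.norm_conj]
  have h3 : 0 ≤ 1 - ‖ζ‖ ^ 2 / s ^ 2 := by
    rw [sub_nonneg, div_le_one (by positivity)]
    gcongr
  gcongr

/-- Borel–Carathéodory for `symmQuot`, whose real part is at most `B + ‖g'(0)‖`. The extra `1` makes
the constant positive, and the estimate depends on `g` only through `‖g 0‖` and `‖g'(0)‖`, hence is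
uniform over all lines and functionals. -/
theorem norm_le_of_re_conj_mul_le (hg : DifferentiableOn ℂ g (ball 0 R)) (hsR : s < R)
    (hB0 : 0 ≤ B) (hB : ∀ ζ ∈ sphere (0 : ℂ) s, (conj ζ * g ζ).re ≤ s ^ 2 * B) {t : ℝ}
    (hts : t < s) {ζ : ℂ} (hζ : ‖ζ‖ ≤ t) :
    ‖g ζ‖ ≤ ‖g 0‖ + t * (2 * (B + ‖deriv g 0‖ + 1) * t / (s - t) +
      ‖deriv g 0‖ * (s + t) / (s - t) + ‖g 0‖ * t / s ^ 2) := by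
  have ht0 : 0 ≤ t := (norm_nonneg _).trans hζ
  have hs : 0 < s := ht0.trans_lt hts
  have hpd := differentiableOn_symmQuot (s := s) hg (hs.trans hsR)
  have hζs : ζ ∈ ball (0 : ℂ) s := mem_ball_zero_iff.2 (hζ.trans_lt hts)
  have h1 : ‖symmQuot g s ζ‖ ≤ 2 * (B + ‖deriv g 0‖ + 1) * ‖ζ‖ / (s - ‖ζ‖) +
      ‖symmQuot g s 0‖ * (s + ‖ζ‖) / (s - ‖ζ‖) := by
    refine Complex.borelCaratheodory (by positivity) (hpd.mono (ball_subset_ball hsR.le))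
      (fun w hw => ?_) hs hζs
    have h2 := re_le_of_re_le_sphere hpd hsR (re_symmQuot_le_sphere hs hB) hw
    rw [symmQuot_zero] at h2
    rw [mem_ball_zero_iff] at hw
    have h3 : (deriv g 0).re ≤ ‖deriv g 0‖ := Complex.re_le_norm _
    have h4 : (s - ‖w‖) / (s + ‖w‖) ≤ 1 := by
      rw [div_le_one (by positivity)]; linarith [norm_nonneg w]
    have h4' : 0 ≤ (s - ‖w‖) / (s + ‖w‖) := div_nonneg (by linarith) (by positivity)
    have h5 : 2 * ‖w‖ / (s + ‖w‖) ≤ 1 := by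
      rw [div_le_one (by positivity)]; linarith
    have h6 := mul_le_mul_of_nonneg_left h3 h4'
    have h7 := mul_le_mul_of_nonneg_right h4 (norm_nonneg (deriv g 0))
    have h8 := mul_le_mul_of_nonneg_right h5 hB0
    show (symmQuot g s w).re ≤ _
    linarith
  rw [symmQuot_zero] at h1
  have h2 : g ζ = g 0 + ζ * (symmQuot g s ζ - conj (g 0) * ζ / (s : ℂ) ^ 2) := by
    have := sub_smul_dslope g 0 ζ
    rw [sub_zero, smul_eq_mul] at this
    rw [symmQuot, add_sub_cancel_right, this]; ring
  have hst : 0 < s - t := by linarith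
  rw [h2]
  refine (norm_add_le _ _).trans ?_
  rw [norm_mul]
  gcongr
  refine (norm_sub_le _ _).trans ?_
  rw [norm_div, norm_mul, RCLike.norm_conj, norm_pow, Complex.norm_real, Real.norm_of_nonneg hs.le]
  gcongr
  refine h1.trans ?_
  gcongr

end Disc

/-! ### Mappings of the ball, by restriction to complex lines. -/

section Ball

variable {h : X → X} {R s N : ℝ}

/-- `L` bounds the numerical range of `h'(0)`. -/
theorem re_fderiv_le_derivSup (h : X → X) {u : X} (hu : u ∈ sphere (0 : X) 1) {l : X →L[ℂ] ℂ}
    (hl : l ∈ dualityMap u) : (l (fderiv ℂ h 0 u)).re ≤ derivSup h := by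
  have hle : (((l (fderiv ℂ h 0 u)).re : ℝ) : EReal) ≤
      supRe (fun u => fderiv ℂ h 0 u) (sphere 0 1) :=
    le_iSup₂_of_le u hu (le_iSup₂_of_le l hl le_rfl)
  have htop : supRe (fun u => fderiv ℂ h 0 u) (sphere 0 1) ≤ (‖fderiv ℂ h 0‖ : EReal) := by
    refine iSup₂_le fun v hv => iSup₂_le fun k hk => ?_
    rw [EReal.coe_le_coe_iff]
    refine (Complex.re_le_norm _).trans ((k.le_opNorm _).trans ?_)
    rw [mem_sphere_zero_iff_norm] at hv
    rw [norm_of_mem_dualityMap hk, hv, one_mul]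
    simpa [hv] using (fderiv ℂ h 0).le_opNorm v
  have h1 : supRe (fun u => fderiv ℂ h 0 u) (sphere 0 1) ≠ ⊤ :=
    ne_top_of_le_ne_top (EReal.coe_ne_top _) htop
  have h2 : supRe (fun u => fderiv ℂ h 0 u) (sphere 0 1) ≠ ⊥ :=
    ne_bot_of_le_ne_bot (EReal.coe_ne_bot _) hle
  rw [← EReal.coe_toReal h1 h2, EReal.coe_le_coe_iff] at hle
  exact hle

theorem derivSup_le [Nontrivial X] {a : ℝ} (ha : ∀ u ∈ sphere (0 : X) 1, ∀ l ∈ dualityMap u,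
    (l (fderiv ℂ h 0 u)).re ≤ a) : derivSup h ≤ a := by
  obtain ⟨u, hu⟩ := exists_norm_eq X zero_le_one
  obtain ⟨l, hl⟩ := dualityMap_nonempty u
  have hle : (((l (fderiv ℂ h 0 u)).re : ℝ) : EReal) ≤
      supRe (fun u => fderiv ℂ h 0 u) (sphere 0 1) :=
    le_iSup₂_of_le u (by simpa using hu) (le_iSup₂_of_le l hl le_rfl)
  have htop : supRe (fun u => fderiv ℂ h 0 u) (sphere 0 1) ≤ (a : EReal) :=
    iSup₂_le fun v hv => iSup₂_le fun k hk => EReal.coe_le_coe_iff.2 (ha v hv k hk)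
  have := EReal.toReal_le_toReal htop (ne_bot_of_le_ne_bot (EReal.coe_ne_bot _) hle)
    (EReal.coe_ne_top _)
  rwa [EReal.toReal_coe] at this

theorem conj_mul_line {u : X} {l : X →L[ℂ] ℂ} (hu : u ∈ sphere (0 : X) 1) (hl : l ∈ dualityMap u)
    {a : ℝ} (hN : ∀ x ∈ sphere (0 : X) s, ∀ k ∈ dualityMap x, (k (h x)).re ≤ a) :
    ∀ ζ ∈ sphere (0 : ℂ) s, (conj ζ * l (h (ζ • u))).re ≤ a := by
  intro ζ hζ
  refine hN (ζ • u) ?_ (conj ζ • l) (smul_mem_dualityMap hl ζ)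
  rw [mem_sphere_zero_iff_norm] at hu hζ ⊢
  rw [norm_smul, hu, hζ, mul_one]

theorem differentiableOn_apply_line (hh : DifferentiableOn ℂ h (ball 0 R)) {u : X}
    (hu : u ∈ sphere (0 : X) 1) (l : X →L[ℂ] ℂ) :
    DifferentiableOn ℂ (fun ζ : ℂ => l (h (ζ • u))) (ball 0 R) := by
  refine l.differentiable.comp_differentiableOn (hh.comp (by fun_prop) fun ζ hζ => ?_)
  rw [mem_sphere_zero_iff_norm] at hu
  rw [mem_ball_zero_iff] at hζ ⊢
  rwa [norm_smul, hu, mul_one]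

theorem deriv_apply_line (hh : DifferentiableOn ℂ h (ball 0 R)) (hR : 0 < R) (u : X)
    (l : X →L[ℂ] ℂ) : deriv (fun ζ : ℂ => l (h (ζ • u))) 0 = l (fderiv ℂ h 0 u) := by
  have h1 : HasFDerivAt h (fderiv ℂ h 0) ((0 : ℂ) • u) := by
    rw [zero_smul]
    exact (hh.differentiableAt (ball_mem_nhds 0 hR)).hasFDerivAt
  have h2 : HasDerivAt (fun ζ : ℂ => ζ • u) u 0 := by
    simpa using (hasDerivAt_id (0 : ℂ)).smul_const u
  exact (l.hasFDerivAt.comp_hasDerivAt 0 (h1.comp_hasDerivAt 0 h2)).deriv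

/-- Growth of the numerical range inside the ball, from a bound on one sphere. -/
theorem re_apply_le_of_sphere (hh : DifferentiableOn ℂ h (ball 0 R)) (hsR : s < R)
    (hN : ∀ x ∈ sphere (0 : X) s, ∀ k ∈ dualityMap x, (k (h x)).re ≤ N) {x : X} (hx0 : 0 < ‖x‖)
    (hx : ‖x‖ < s) {l : X →L[ℂ] ℂ} (hl : l ∈ dualityMap x) :
    (l (h x)).re ≤ ‖x‖ * ‖h 0‖ * (1 - ‖x‖ ^ 2 / s ^ 2) +
      ‖x‖ ^ 2 * ((s - ‖x‖) / (s + ‖x‖) * derivSup h + 2 * ‖x‖ / (s + ‖x‖) * (N / s ^ 2)) := by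
  have hs : 0 < s := hx0.trans hx
  have hxC : (‖x‖ : ℂ) ≠ 0 := by exact_mod_cast hx0.ne'
  set u : X := (‖x‖ : ℂ)⁻¹ • x with hu
  have hxu : (‖x‖ : ℂ) • u = x := by rw [hu, smul_inv_smul₀ hxC]
  have hu1 : u ∈ sphere (0 : X) 1 := by
    rw [mem_sphere_zero_iff_norm, hu, norm_smul, norm_inv, Complex.norm_real, norm_norm,
      inv_mul_cancel₀ hx0.ne']
  set k : X →L[ℂ] ℂ := (‖x‖ : ℂ)⁻¹ • l with hk
  have hku : k ∈ dualityMap u := by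
    have := smul_mem_dualityMap hl (‖x‖ : ℂ)⁻¹
    rwa [map_inv₀, Complex.conj_ofReal] at this
  have hlk : l = (‖x‖ : ℂ) • k := by rw [hk, smul_inv_smul₀ hxC]
  have hk1 : ‖k‖ = 1 := by
    rw [norm_of_mem_dualityMap hku, mem_sphere_zero_iff_norm.1 hu1]
  have key := re_conj_mul_le (g := fun ζ : ℂ => k (h (ζ • u))) (B := N / s ^ 2) (s := s)
    (differentiableOn_apply_line hh hu1 k) hsR (fun ζ hζ => by
      rw [mul_div_cancel₀ _ (by positivity : s ^ 2 ≠ 0)]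
      exact conj_mul_line hu1 hku hN ζ hζ) (ζ := (‖x‖ : ℂ)) (by simpa using hx)
  rw [deriv_apply_line hh (hs.trans hsR)] at key
  simp only [hxu, Complex.conj_ofReal, Complex.norm_real, norm_norm, zero_smul] at key
  have e : l (h x) = (‖x‖ : ℂ) * k (h x) := by rw [hlk]; simp
  rw [e]
  refine key.trans ?_
  have h0 : ‖k (h 0)‖ ≤ ‖h 0‖ := by simpa [hk1] using k.le_opNorm (h 0)
  have h1 : 0 ≤ 1 - ‖x‖ ^ 2 / s ^ 2 := by
    rw [sub_nonneg, div_le_one (by positivity)]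
    gcongr
  have h2 : 0 ≤ (s - ‖x‖) / (s + ‖x‖) := div_nonneg (by linarith) (by positivity)
  have h3 := re_fderiv_le_derivSup h hu1 hku
  gcongr

/-- `symmQuot` takes the value `l (h'(0) u)` at the origin, and the mean value property bounds its
real part there by the bound on the circle. -/
theorem sq_mul_derivSup_le_of_sphere [Nontrivial X] (hh : DifferentiableOn ℂ h (ball 0 R))
    (hs : 0 < s) (hsR : s < R)
    (hN : ∀ x ∈ sphere (0 : X) s, ∀ k ∈ dualityMap x, (k (h x)).re ≤ N) :
    s ^ 2 * derivSup h ≤ N := by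
  rw [← le_div_iff₀' (by positivity)]
  refine derivSup_le fun u hu l hl => ?_
  have := re_zero_le_of_re_le_sphere
    (differentiableOn_symmQuot (s := s) (differentiableOn_apply_line hh hu l) (hs.trans hsR))
    hs hsR (re_symmQuot_le_sphere hs (B := N / s ^ 2) fun ζ hζ => by
      rw [mul_div_cancel₀ _ (by positivity : s ^ 2 ≠ 0)]
      exact conj_mul_line hu hl hN ζ hζ)
  rwa [symmQuot_zero, deriv_apply_line hh (hs.trans hsR)] at this

/-- A one-sided bound of the numerical range on a sphere bounds `h` on every smaller ball. -/
theorem exists_norm_le_of_sphere [CompleteSpace X] (hh : DifferentiableOn ℂ h (ball 0 R))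
    (hsR : s < R) (hN : ∀ x ∈ sphere (0 : X) s, ∀ k ∈ dualityMap x, (k (h x)).re ≤ N)
    {r : ℝ} (hr : 0 < r) (hrs : r < s) : ∃ M, ∀ x ∈ ball (0 : X) r, ‖h x‖ ≤ M := by
  obtain ⟨t, hrt, hts⟩ := exists_between hrs
  have ht : 0 < t := hr.trans hrt
  have hs : 0 < s := ht.trans hts
  set B : ℝ := |N| / s ^ 2 with hB
  have hst : 0 < s - t := by linarith
  set A : ℝ := ‖h 0‖ + t * (2 * (B + ‖fderiv ℂ h 0‖ + 1) * t / (s - t) +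
      ‖fderiv ℂ h 0‖ * (s + t) / (s - t) + ‖h 0‖ * t / s ^ 2) with hA
  have hA0 : 0 ≤ A := by positivity
  refine exists_norm_le_of_numericalRange_bounded (C := A + 1) hh hr hrt (hts.trans hsR)
    (by positivity) fun u hu l hl ζ hζ => ?_
  have hu1 := mem_sphere_zero_iff_norm.1 hu
  have hl1 : ‖l‖ = 1 := by rw [norm_of_mem_dualityMap hl, hu1]
  have key := norm_le_of_re_conj_mul_le (g := fun ζ : ℂ => l (h (ζ • u))) (B := B) (s := s)
    (differentiableOn_apply_line hh hu l) hsR (by positivity) (fun ξ hξ => by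
      rw [hB, mul_div_cancel₀ _ (by positivity : s ^ 2 ≠ 0)]
      exact (conj_mul_line hu hl hN ξ hξ).trans (le_abs_self N)) hts hζ
  rw [deriv_apply_line hh (hs.trans hsR)] at key
  simp only [zero_smul] at key
  have h0 : ‖l (h 0)‖ ≤ ‖h 0‖ := by simpa [hl1] using l.le_opNorm (h 0)
  have h1 : ‖l (fderiv ℂ h 0 u)‖ ≤ ‖fderiv ℂ h 0‖ := by
    refine (l.le_opNorm _).trans ?_
    rw [hl1, one_mul]
    simpa [hu1] using (fderiv ℂ h 0).le_opNorm u
  have h2 : ‖l (h (ζ • u))‖ ≤ A := by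
    refine key.trans ?_
    rw [hA]
    gcongr
  linarith

end Ball

end Growth

/-! ### Unique solvability and the resolvent. -/

section Resolvent

open Metric

variable {h : X → X} {R N : ℝ}

/-- `N` is an asymptotic upper bound of `Re ⟨h(x), x*⟩` on the spheres `‖x‖ = s`, `s → R⁻`. -/
def IsBoundaryBound (h : X → X) (R N : ℝ) : Prop :=
  ∀ ε > 0, ∀ᶠ s in 𝓝[<] R, ∀ x ∈ sphere (0 : X) s, ∀ k ∈ dualityMap x, (k (h x)).re ≤ N + ε

theorem le_supRe {f : X → X} {S : Set X} {x : X} (hx : x ∈ S) {l : X →L[ℂ] ℂ}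
    (hl : l ∈ dualityMap x) : (((l (f x)).re : ℝ) : EReal) ≤ supRe f S :=
  le_iSup₂_of_le x hx (le_iSup₂_of_le l hl le_rfl)

theorem eventually_mem_Ioo {R : ℝ} {a : ℝ} (ha : a < R) : ∀ᶠ s in 𝓝[<] R, s ∈ Ioo a R :=
  Ioo_mem_nhdsLT ha

theorem IsBoundaryBound.sq_mul_derivSup_le [Nontrivial X] (hR : 0 < R)
    (hh : DifferentiableOn ℂ h (ball 0 R)) (hN : IsBoundaryBound h R N) :
    R ^ 2 * derivSup h ≤ N := by
  refine le_of_forall_pos_le_add fun ε hε => ?_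
  have hc : Continuous fun s : ℝ => s ^ 2 * derivSup h := by fun_prop
  refine le_of_tendsto ((hc.tendsto R).mono_left (nhdsWithin_le_nhds (s := Iio R))) ?_
  filter_upwards [hN ε hε, eventually_mem_Ioo hR] with s hs hsR
  exact sq_mul_derivSup_le_of_sphere hh hsR.1 hsR.2 hs

/-- The property shared by both choices of `N_R`. Since `toReal` sends `⊥` to `0`, the value `⊥`
must be excluded: the ball supremum is at least `0` because of `x = 0`, and a boundary supremum `⊥`
would allow the bound `R² L - 1`, against `R² L ≤ N`. -/
theorem isBoundaryBound_toReal [Nontrivial X] (hR : 0 < R)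
    (hh : DifferentiableOn ℂ h (ball 0 R)) {NR : EReal}
    (hNR : NR = ballSup h R ∨ NR = boundarySup h R) (hfin : NR < ⊤) :
    IsBoundaryBound h R NR.toReal := by
  rcases hNR with hNR | hNR
  · have h0 : NR ≠ ⊥ := by
      rw [hNR]
      exact ne_bot_of_le_ne_bot (EReal.coe_ne_bot _) (le_supRe (f := h) (x := 0)
        (mem_ball_self hR) (l := 0) (by simp [dualityMap]))
    intro ε hε
    filter_upwards [eventually_mem_Ioo hR] with s hs x hx k hk
    have h1 : (((k (h x)).re : ℝ) : EReal) ≤ NR :=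
      hNR ▸ le_supRe (f := h) (sphere_subset_ball hs.2 hx) hk
    rw [← EReal.coe_toReal hfin.ne h0, EReal.coe_le_coe_iff] at h1
    linarith
  · have hlt : ∀ a : ℝ, NR < a →
        ∀ᶠ s in 𝓝[<] R, ∀ x ∈ sphere (0 : X) s, ∀ k ∈ dualityMap x, (k (h x)).re ≤ a := by
      intro a ha
      rw [hNR] at ha
      filter_upwards [eventually_lt_of_limsup_lt ha] with s hs x hx k hk
      exact EReal.coe_le_coe_iff.1 ((le_supRe (f := h) hx hk).trans hs.le)
    have h0 : NR ≠ ⊥ := by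
      intro hbot
      have hb : IsBoundaryBound h R (R ^ 2 * derivSup h - 1) := fun ε hε => by
        filter_upwards [hlt _ (hbot ▸ EReal.bot_lt_coe (R ^ 2 * derivSup h - 1))]
          with s hs x hx k hk
        linarith [hs x hx k hk]
      linarith [hb.sq_mul_derivSup_le hR hh]
    intro ε hε
    refine hlt _ ?_
    nth_rw 1 [← EReal.coe_toReal hfin.ne h0]
    rw [EReal.coe_lt_coe_iff]
    linarith

/-- Growth of the numerical range: `Re ⟨h(x), x*⟩ ≤ r ω(r)` for `‖x‖ = r`. -/
theorem IsBoundaryBound.re_apply_le (hh : DifferentiableOn ℂ h (ball 0 R))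
    (hN : IsBoundaryBound h R N) {x : X} (hx0 : 0 < ‖x‖) (hx : ‖x‖ < R) {l : X →L[ℂ] ℂ}
    (hl : l ∈ dualityMap x) : (l (h x)).re ≤ ‖x‖ * omegaFn h R N ‖x‖ := by
  have hR : 0 < R := hx0.trans hx
  set r := ‖x‖ with hr
  set Ψ : ℝ → ℝ → ℝ := fun s a => r * ‖h 0‖ * (1 - r ^ 2 / s ^ 2) +
      r ^ 2 * ((s - r) / (s + r) * derivSup h + 2 * r / (s + r) * (a / s ^ 2)) with hΨ
  have h1 : ∀ ε > 0, (l (h x)).re ≤ Ψ R (N + ε) := by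
    intro ε hε
    have hc : ContinuousAt (fun s => Ψ s (N + ε)) R := by
      have e1 : R ^ 2 ≠ 0 := by positivity
      have e2 : R + r ≠ 0 := by positivity
      simp only [hΨ]
      fun_prop (disch := assumption)
    refine ge_of_tendsto (hc.tendsto.mono_left (nhdsWithin_le_nhds (s := Iio R))) ?_
    filter_upwards [hN ε hε, eventually_mem_Ioo hx] with s hs hsR
    exact re_apply_le_of_sphere hh hsR.2 hs hx0 hsR.1 hl
  have h2 : (l (h x)).re ≤ Ψ R N := by
    have hc : Continuous fun ε => Ψ R (N + ε) := by simp only [hΨ]; fun_prop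
    refine ge_of_tendsto ((hc.tendsto' 0 (Ψ R N) (by simp)).mono_left
      (nhdsWithin_le_nhds (s := Ioi 0))) ?_
    filter_upwards [self_mem_nhdsWithin] with ε hε
    exact h1 ε hε
  refine h2.trans_eq ?_
  have e2 : R + r ≠ 0 := by positivity
  simp only [hΨ, omegaFn]
  field_simp

theorem IsBoundaryBound.existsUnique [CompleteSpace X] (hh : DifferentiableOn ℂ h (ball 0 R))
    (hN : IsBoundaryBound h R N) {r : ℝ} (hr : r ∈ Ioo 0 R) {z : X} {lam : ℂ}
    (hlam : (1 / r) * (omegaFn h R N r + ‖z‖) < lam.re) :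
    (∃! x : X, x ∈ ball 0 r ∧ lam • x - h x = z) ∧
      ∀ x ∈ ball (0 : X) r, lam • x - h x = z →
        IsUnit (fderiv ℂ (fun y => lam • y - h y) x) := by
  obtain ⟨hr0, hrR⟩ := hr
  obtain ⟨s, hsN, hrs, hsR⟩ := ((hN 1 one_pos).and (eventually_mem_Ioo hrR)).exists
  obtain ⟨r', hrr', hr's⟩ := exists_between hrs
  obtain ⟨M, hM⟩ := exists_norm_le_of_sphere hh hsR hsN (hr0.trans hrr') hr's
  have hsub : ball (0 : X) r' ⊆ ball 0 R := ball_subset_ball (hr's.trans hsR).le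
  have hd : DifferentiableOn ℂ (fun x => lam • x - h x - z) (ball 0 r') := by
    have := hh.mono hsub
    fun_prop
  rw [one_div, inv_mul_lt_iff₀ hr0] at hlam
  obtain ⟨h1, h2⟩ := existsUnique_zero_of_bounded hr0 hrr'
    (δ := r * (r * lam.re - (omegaFn h R N r + ‖z‖))) (mul_pos hr0 (by linarith)) hd
    (M := ‖lam‖ * r' + M + ‖z‖)
    (fun x hx => by
      have hx' := mem_ball_zero_iff.1 hx
      refine (norm_sub_le _ _).trans ?_
      gcongr
      refine (norm_sub_le _ _).trans ?_
      rw [norm_smul]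
      gcongr
      exact hM x hx)
    (fun y hy l hl => by
      have hy' := mem_sphere_zero_iff_norm.1 hy
      have e1 : (l y) = ((r ^ 2 : ℝ) : ℂ) := by rw [hl.1, hy']
      have e2 := hN.re_apply_le hh (by rwa [hy']) (by rwa [hy']) hl
      rw [hy'] at e2
      have e3 : (l z).re ≤ r * ‖z‖ := by
        refine (Complex.re_le_norm _).trans ((l.le_opNorm z).trans_eq ?_)
        rw [norm_of_mem_dualityMap hl, hy']
      have e4 : (lam * ((r ^ 2 : ℝ) : ℂ)).re = lam.re * r ^ 2 := Complex.re_mul_ofReal _ _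
      simp only [map_sub, map_smul, Complex.sub_re, smul_eq_mul, e1, e4]
      linarith)
  simp only [sub_eq_zero, fderiv_sub_const] at h1 h2
  exact ⟨h1, h2⟩

/-- Because `L ≤ N / R²`, replacing `N / R²` by `L` only lowers `ω`. Hence `Re λ > μ(r)` puts `Re λ`
above `L`, as inversion near the origin requires. -/
theorem derivSup_le_muFn [Nontrivial X] (hh : DifferentiableOn ℂ h (ball 0 R))
    (hN : IsBoundaryBound h R N) {r : ℝ} (hr : r ∈ Ioo 0 R) :
    derivSup h ≤ 1 / r * omegaFn h R N r := by
  obtain ⟨hr0, hrR⟩ := hr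
  have hR : 0 < R := hr0.trans hrR
  have h1 := hN.sq_mul_derivSup_le hR hh
  have h2 : derivSup h ≤ N / R ^ 2 := by rwa [le_div_iff₀' (by positivity)]
  have h3 : 0 ≤ ‖h 0‖ * (1 - r ^ 2 / R ^ 2) := by
    refine mul_nonneg (norm_nonneg _) ?_
    rw [sub_nonneg, div_le_one (by positivity)]
    gcongr
  have h4 : r * derivSup h ≤ r / (R + r) * ((R - r) * derivSup h + 2 * r * (N / R ^ 2)) := by
    have e : r * derivSup h = r / (R + r) * ((R - r) * derivSup h + 2 * r * derivSup h) := by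
      field_simp; ring
    rw [e]
    gcongr
  rw [one_div, ← div_eq_inv_mul, le_div_iff₀' hr0, omegaFn]
  linarith

/-- Near the origin `lam I - h` is injective with invertible derivatives if `L < Re lam`. -/
theorem exists_injOn_nhds_zero [CompleteSpace X] (hR : 0 < R)
    (hh : DifferentiableOn ℂ h (ball 0 R)) {lam : ℂ} (hlam : derivSup h < lam.re) :
    ∃ D : Set X, IsOpen D ∧ (0 : X) ∈ D ∧ InjOn (fun x => lam • x - h x) D ∧
      ∀ x ∈ D, IsUnit (fderiv ℂ (fun y => lam • y - h y) x) := by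
  set G : X → X := fun x => lam • x - h x with hG
  have hGd : DifferentiableOn ℂ G (ball 0 R) := by fun_prop
  have h0 : (0 : X) ∈ ball 0 R := mem_ball_self hR
  have hfd : fderiv ℂ G 0 = lam • ContinuousLinearMap.id ℂ X - fderiv ℂ h 0 :=
    (((hasFDerivAt_id (0 : X)).const_smul lam).sub
      (hh.differentiableAt (ball_mem_nhds 0 hR)).hasFDerivAt).fderiv
  set A : X →L[ℂ] X := fderiv ℂ G 0 with hA
  -- The linear map `A = λ - h'(0)` is itself strictly accretive on the unit sphere and is its own
  -- derivative, so the zero theorem at the origin gives its invertibility.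
  have hunit : IsUnit A := by
    have h1 := (existsUnique_zero_of_bounded (G := A) (r := 1) (r' := 2) (M := ‖A‖ * 2)
      (δ := lam.re - derivSup h) one_pos one_lt_two (by linarith) A.differentiable.differentiableOn
      (fun x hx => (A.le_opNorm x).trans (by
        rw [mem_ball_zero_iff] at hx
        gcongr))
      (fun y hy l hl => by
        have e1 : l y = 1 := by rw [hl.1, mem_sphere_zero_iff_norm.1 hy]; simp
        have e2 := re_fderiv_le_derivSup h hy hl
        rw [hfd]
        simp only [sub_apply, smul_apply, ContinuousLinearMap.id_apply, map_sub, map_smul, e1,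
          Complex.sub_re, smul_eq_mul, mul_one]
        linarith)).2 0 (mem_ball_self one_pos) (map_zero A)
    rwa [ContinuousLinearMap.fderiv] at h1
  have hev : ∀ᶠ x in 𝓝 (0 : X), IsUnit (fderiv ℂ G x) :=
    (continuousAt_fderiv isOpen_ball hGd h0).eventually (Units.isOpen.mem_nhds hunit)
  obtain ⟨u, hu⟩ := hunit
  have hs : HasStrictFDerivAt G ((ContinuousLinearEquiv.ofUnit u : X ≃L[ℂ] X) : X →L[ℂ] X) 0 := by
    have := hasStrictFDerivAt_of_holomorphic isOpen_ball hGd h0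
    rw [← hA, ← hu] at this
    exact this
  obtain ⟨ρ, hρ, hρs⟩ := Metric.eventually_nhds_iff_ball.1 (hev.and
    ((hs.toOpenPartialHomeomorph G).open_source.mem_nhds hs.mem_toOpenPartialHomeomorph_source))
  refine ⟨ball 0 ρ, isOpen_ball, mem_ball_self hρ, ?_, fun x hx => (hρs x hx).1⟩
  intro x hx y hy hxy
  exact (hs.toOpenPartialHomeomorph G).injOn (hρs x hx).2 (hρs y hy).2 hxy

theorem IsBoundaryBound.exists_isResolvent [CompleteSpace X] [Nontrivial X]
    (hh : DifferentiableOn ℂ h (ball 0 R)) (hN : IsBoundaryBound h R N) {r : ℝ}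
    (hr : r ∈ Ioo 0 R) {lam : ℂ} (hlam : (1 / r) * omegaFn h R N r < lam.re) :
    ∃ (D W : Set X) (Φ : X → X), IsResolvent h (ball 0 R) lam D W Φ ∧
      ∀ z : X, (1 / r) * (omegaFn h R N r + ‖z‖) < lam.re → z ∈ W ∧ Φ z ∈ ball 0 r := by
  obtain ⟨hr0, hrR⟩ := id hr
  have hR : 0 < R := hr0.trans hrR
  set G : X → X := fun x => lam • x - h x with hG
  have hsub : ball (0 : X) r ⊆ ball 0 R := ball_subset_ball hrR.le
  have hGd : DifferentiableOn ℂ G (ball 0 R) := by fun_prop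
  have hiff : ∀ z : X, (1 / r) * (omegaFn h R N r + ‖z‖) < lam.re ↔
      z ∈ ball (0 : X) (r * lam.re - omegaFn h R N r) := fun z => by
    rw [one_div, inv_mul_lt_iff₀ hr0, mem_ball_zero_iff, lt_sub_iff_add_lt']
  obtain ⟨D₂, hD₂, h0D₂, hinj₂, hunit₂⟩ := exists_injOn_nhds_zero hR hh
    ((derivSup_le_muFn hh hN hr).trans_lt hlam)
  set D₁ : Set X := ball 0 r ∩ G ⁻¹' ball 0 (r * lam.re - omegaFn h R N r) with hD₁
  have hD₁o : IsOpen D₁ := (hGd.mono hsub).continuousOn.isOpen_inter_preimage isOpen_ball isOpen_ball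
  -- `Re λ > μ(r)` need not place `-h 0` in the ball of uniquely solvable `z`, so `D₁` may miss the
  -- origin and a neighbourhood `D₂` is added. Injectivity survives: a value in that ball has only
  -- one preimage in `ball 0 r`, and any other value is attained only from `D₂`.
  set D : Set X := D₁ ∪ (D₂ ∩ ball 0 r) with hD
  have hDo : IsOpen D := hD₁o.union (hD₂.inter isOpen_ball)
  have hDr : D ⊆ ball 0 r := union_subset inter_subset_left inter_subset_right
  have hsolve : ∀ z ∈ ball (0 : X) (r * lam.re - omegaFn h R N r), _ := fun z hz =>
    hN.existsUnique hh hr ((hiff z).2 hz)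
  have hinj : InjOn G D := by
    intro x hx y hy hxy
    by_cases hz : G x ∈ ball (0 : X) (r * lam.re - omegaFn h R N r)
    · exact (hsolve _ hz).1.unique ⟨hDr hx, rfl⟩ ⟨hDr hy, hxy.symm⟩
    · have hx2 : x ∈ D₂ := (hx.resolve_left fun h' => hz h'.2).1
      have hy2 : y ∈ D₂ := (hy.resolve_left fun h' => hz (hxy ▸ h'.2)).1
      exact hinj₂ hx2 hy2 hxy
  have hunit : ∀ x ∈ D, IsUnit (fderiv ℂ G x) := by
    rintro x (hx | hx)
    · exact (hsolve _ hx.2).2 x hx.1 rfl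
    · exact hunit₂ x hx.1
  obtain ⟨hWo, hΦd⟩ := isOpen_image_and_differentiableOn_invFunOn hDo
    (hGd.mono (hDr.trans hsub)) hinj hunit
  have h0D : (0 : X) ∈ D := Or.inr ⟨h0D₂, mem_ball_self hr0⟩
  refine ⟨D, G '' D, Function.invFunOn G D,
    { isOpen_range := hDo
      range_subset := hDr.trans hsub
      zero_mem := h0D
      isOpen_domain := hWo
      neg_mem := ⟨0, h0D, by simp [hG]⟩
      mapsTo := mapsTo_image G D
      mapsTo_inv := fun z hz => Function.invFunOn_mem hz
      invOn := ⟨hinj.leftInvOn_invFunOn, fun z hz => Function.invFunOn_eq hz⟩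
      holomorphic := hΦd }, fun z hz => ?_⟩
  have hz' := (hiff z).1 hz
  obtain ⟨x, ⟨hx, hxz⟩, -⟩ := (hsolve z hz').1
  have hzW : z ∈ G '' D := ⟨x, Or.inl ⟨hx, show G x ∈ _ from hxz ▸ hz'⟩, hxz⟩
  exact ⟨hzW, hDr (Function.invFunOn_mem hzW)⟩

end Resolvent

/-! ### Minima of `μ`. -/

section Minimum

variable {h : X → X} {R N : ℝ}

/-- The second factor is the difference quotient, so its sign decides monotonicity and its value at
`r = a` is the derivative of `μ`; no differentiation is needed. -/
theorem muFn_sub_muFn {r a : ℝ} (hr : r ∈ Ioo 0 R) (ha : a ∈ Ioo 0 R) :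
    muFn h R N r - muFn h R N a =
      (r - a) * (2 * R * (N / R ^ 2 - derivSup h) / ((R + r) * (R + a)) -
        ‖h 0‖ * (R ^ 2 + r * a) / (R ^ 2 * r * a)) := by
  obtain ⟨hr0, hrR⟩ := hr
  obtain ⟨ha0, haR⟩ := ha
  have hR : 0 < R := hr0.trans hrR
  have e1 : R + r ≠ 0 := by positivity
  have e2 : R + a ≠ 0 := by positivity
  simp only [muFn, omegaFn]
  field_simp
  ring

theorem muFn_sub_muFn_of_zero (h0 : h 0 = 0) {r a : ℝ} (hr : r ∈ Ioo 0 R) (ha : a ∈ Ioo 0 R) :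
    muFn h R N r - muFn h R N a =
      (r - a) * (2 * R * (N / R ^ 2 - derivSup h) / ((R + r) * (R + a))) := by
  rw [muFn_sub_muFn hr ha, h0]
  simp

theorem not_strict_localMin (h0 : h 0 = 0) (hNL : R ^ 2 * derivSup h ≤ N) :
    ¬ ∃ r₀ ∈ Ioo 0 R, ∀ᶠ r in 𝓝[≠] r₀, muFn h R N r₀ < muFn h R N r := by
  rintro ⟨r₀, hr₀, hev⟩
  have hR : 0 < R := hr₀.1.trans hr₀.2
  have h1 : ∀ᶠ r in 𝓝[<] r₀, muFn h R N r₀ < muFn h R N r :=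
    hev.filter_mono (nhdsWithin_mono _ fun _ hx => ne_of_lt hx)
  obtain ⟨r, hr, hr1⟩ := (h1.and (Ioo_mem_nhdsLT hr₀.1 : ∀ᶠ r in 𝓝[<] r₀, r ∈ Ioo 0 r₀)).exists
  have hd : 0 ≤ N / R ^ 2 - derivSup h := by
    rw [sub_nonneg, le_div_iff₀' (by positivity)]; exact hNL
  have h2 := muFn_sub_muFn_of_zero (N := N) h0 hr₀ ⟨hr1.1, hr1.2.trans hr₀.2⟩
  have h3 : 0 ≤ 2 * R * (N / R ^ 2 - derivSup h) / ((R + r₀) * (R + r)) := by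
    have := hr₀.1
    have := hr1.1
    positivity
  have h4 := mul_nonneg (sub_nonneg.2 hr1.2.le) h3
  linarith

theorem muFn_eq_derivSup (h0 : h 0 = 0) (hNL : N = R ^ 2 * derivSup h) {r : ℝ}
    (hr : r ∈ Ioo 0 R) : muFn h R N r = derivSup h := by
  obtain ⟨hr0, hrR⟩ := hr
  have hR : 0 < R := hr0.trans hrR
  have e1 : R + r ≠ 0 := by positivity
  rw [muFn, omegaFn, h0, hNL, norm_zero]
  field_simp
  ring

theorem strictMonoOn_muFn (h0 : h 0 = 0) (hNL : R ^ 2 * derivSup h < N) :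
    StrictMonoOn (muFn h R N) (Ioo 0 R) := by
  intro a ha r hr har
  have hR : 0 < R := ha.1.trans ha.2
  have hd : 0 < N / R ^ 2 - derivSup h := by
    rw [sub_pos, lt_div_iff₀' (by positivity)]; exact hNL
  rw [← sub_pos, muFn_sub_muFn_of_zero h0 hr ha]
  have := hr.1
  have := ha.1
  have := sub_pos.2 har
  positivity

/-- The difference quotient is nonnegative to the right of `r₀`, hence in the limit `2 R³ d r₀² ≥ c
(R² + r₀²)(R + r₀)²`. By the AM–GM inequality, strict since `r₀ < R`, the right side exceeds `8 c R²
r₀²`. -/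
theorem lt_of_isLocalMin (h0 : h 0 ≠ 0) {r₀ : ℝ} (hr₀ : r₀ ∈ Ioo 0 R)
    (hmin : IsLocalMin (muFn h R N) r₀) : 4 * ‖h 0‖ < R * (N / R ^ 2 - derivSup h) := by
  have hc : 0 < ‖h 0‖ := norm_pos_iff.2 h0
  obtain ⟨h1, h2⟩ := id hr₀
  have hR : 0 < R := h1.trans h2
  set d := N / R ^ 2 - derivSup h with hd
  set φ : ℝ → ℝ := fun r => 2 * R * d / ((R + r) * (R + r₀)) -
    ‖h 0‖ * (R ^ 2 + r * r₀) / (R ^ 2 * r * r₀) with hφ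
  have hφc : ContinuousAt φ r₀ := by
    have e1 : (R + r₀) * (R + r₀) ≠ 0 := by positivity
    have e2 : R ^ 2 * r₀ * r₀ ≠ 0 := by positivity
    simp only [hφ]
    fun_prop (disch := assumption)
  have h3 : 0 ≤ φ r₀ := by
    refine ge_of_tendsto (hφc.tendsto.mono_left (nhdsWithin_le_nhds (s := Ioi r₀))) ?_
    filter_upwards [hmin.filter_mono nhdsWithin_le_nhds, Ioo_mem_nhdsGT h2] with r hr hrI
    have h4 := muFn_sub_muFn (h := h) (N := N) ⟨h1.trans hrI.1, hrI.2⟩ hr₀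
    have h5 : 0 ≤ (r - r₀) * φ r := by
      rw [← h4]; exact sub_nonneg.2 hr
    exact nonneg_of_mul_nonneg_right h5 (sub_pos.2 hrI.1)
  simp only [hφ] at h3
  rw [sub_nonneg, div_le_div_iff₀ (by positivity) (by positivity)] at h3
  have h6 : 2 * R * r₀ < R ^ 2 + r₀ ^ 2 := by nlinarith [sq_pos_of_pos (sub_pos.2 h2)]
  have h7 : 4 * R * r₀ ≤ (R + r₀) ^ 2 := by nlinarith [sq_nonneg (R - r₀)]
  have h8 : (2 * R * r₀) * (4 * R * r₀) < (R ^ 2 + r₀ ^ 2) * (R + r₀) ^ 2 :=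
    mul_lt_mul h6 h7 (by positivity) (by positivity)
  have h9 := mul_lt_mul_of_pos_left h8 hc
  have h10 : (2 * R ^ 2 * r₀ ^ 2) * (4 * ‖h 0‖) < (2 * R ^ 2 * r₀ ^ 2) * (R * d) := by
    linarith
  exact lt_of_mul_lt_mul_left h10 (by positivity)

/-- With `τ = a / R`, the critical equation is `2 R d τ² = c (τ² + 1)(τ + 1)²`. Under `β = τ + 1/τ`
it becomes `c (β² + 2 β) = 2 R d`, whose positive root is `betaCoeff`; the hypothesis says `β > 2`,
and `τ` is the smaller root of `τ² - β τ + 1`. -/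
theorem rStar_mem_and_isMinOn (hR : 0 < R) (h0 : h 0 ≠ 0)
    (hlt : 4 * ‖h 0‖ < R * (N / R ^ 2 - derivSup h)) :
    rStar h R N ∈ Ioo 0 R ∧ IsMinOn (muFn h R N) (Ioo 0 R) (rStar h R N) := by
  have hc : 0 < ‖h 0‖ := norm_pos_iff.2 h0
  set c := ‖h 0‖ with hcdef
  set d := N / R ^ 2 - derivSup h with hd
  set β := betaCoeff h R N with hβ
  set S := Real.sqrt (c ^ 2 + 2 * R * d * c) with hS
  have hSsq : S ^ 2 = c ^ 2 + 2 * R * d * c := Real.sq_sqrt (by nlinarith)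
  have hβS : (β + 1) * c = S := by
    have : β = (S - c) / c := rfl
    rw [this]; field_simp; ring
  have hS3 : 3 * c < S := Real.lt_sqrt_of_sq_lt (by nlinarith)
  have hβ2 : 2 < β := by
    by_contra! hle
    nlinarith
  have hβeq : c * (β ^ 2 + 2 * β) = 2 * R * d := by
    have : c * (c * (β ^ 2 + 2 * β)) = c * (2 * R * d) := by
      rw [← hβS] at hSsq
      linarith
    exact mul_left_cancel₀ hc.ne' this
  set T := Real.sqrt (β ^ 2 - 4) with hT
  have hTsq : T ^ 2 = β ^ 2 - 4 := Real.sq_sqrt (by nlinarith)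
  have hT0 : 0 ≤ T := Real.sqrt_nonneg _
  have hT1 : T < β := by nlinarith
  have hT2 : β - 2 < T := Real.lt_sqrt_of_sq_lt (by nlinarith)
  set τ := (β - T) / 2 with hτ
  have hτ0 : 0 < τ := by linarith
  have hτ1 : τ < 1 := by linarith
  have hτeq : β * τ = τ ^ 2 + 1 := by rw [hτ]; linarith
  set a := rStar h R N with ha
  have haτ : a = R * τ := rfl
  have ha0 : 0 < a := haτ ▸ mul_pos hR hτ0
  have haR : a < R := by rw [haτ]; nlinarith
  have hkey : 2 * R * d * (R ^ 2 * a ^ 2) = c * (a ^ 2 + R ^ 2) * (a + R) ^ 2 := by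
    have e : (β ^ 2 + 2 * β) * τ ^ 2 = (τ ^ 2 + 1) * (τ + 1) ^ 2 := by
      have : (β ^ 2 + 2 * β) * τ ^ 2 = (β * τ) * (β * τ + 2 * τ) := by ring
      rw [this, hτeq]; ring
    rw [← hβeq, haτ]
    calc _ = R ^ 4 * c * ((β ^ 2 + 2 * β) * τ ^ 2) := by ring
      _ = _ := by rw [e]; ring
  refine ⟨⟨ha0, haR⟩, fun r hr => ?_⟩
  obtain ⟨hr0, hrR⟩ := id hr
  show muFn h R N a ≤ muFn h R N r
  rw [← sub_nonneg, muFn_sub_muFn hr ⟨ha0, haR⟩]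
  have e2 : 2 * R * d = c * (a ^ 2 + R ^ 2) * (a + R) ^ 2 / (R ^ 2 * a ^ 2) := by
    rw [eq_div_iff (by positivity), hkey]
  -- Eliminating `d` by the critical equation extracts a second factor `r - a`. The cofactor is
  -- nonnegative on all of `(0, R)`, so the minimum is global.
  have e3 : (r - a) * (2 * R * d / ((R + r) * (R + a)) - c * (R ^ 2 + r * a) / (R ^ 2 * r * a)) =
      (r - a) ^ 2 * (c * (R ^ 3 - a ^ 2 * r)) / (R ^ 2 * a ^ 2 * r * (R + r)) := by
    have e4 : R + r ≠ 0 := by positivity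
    have e5 : R + a ≠ 0 := by positivity
    rw [e2]
    field_simp
    ring
  rw [e3]
  have h3 : a ^ 2 * r ≤ R ^ 3 := by
    calc a ^ 2 * r ≤ R ^ 2 * R := by gcongr
      _ = R ^ 3 := by ring
  have h4 := sub_nonneg.2 h3
  positivity

end Minimum

end HolRange

end

/-! ### Assembly of the four parts. -/

theorem mainTheorem9 {X : Type*} [NormedAddCommGroup X] [NormedSpace ℂ X] [CompleteSpace X]
    [Nontrivial X] (R : ℝ) (hR : 0 < R) (h : X → X)
    (hh : DifferentiableOn ℂ h (Metric.ball 0 R))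
    (NR : EReal) (hNR : NR = HolRange.ballSup h R ∨ NR = HolRange.boundarySup h R)
    (hfin : NR < ⊤) :
    -- (i) unique solvability of the resolvent equation in the ball of radius `r`
    (∀ r ∈ Ioo 0 R, ∀ (z : X) (lam : ℂ),
      (1 / r) * (HolRange.omegaFn h R NR.toReal r + ‖z‖) < lam.re →
        ∃! x : X, x ∈ Metric.ball 0 r ∧ lam • x - h x = z) ∧
    -- (i) the solution is the value at `z` of the resolvent
    (∀ r ∈ Ioo 0 R, ∀ lam : ℂ, (1 / r) * HolRange.omegaFn h R NR.toReal r < lam.re →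
      ∃ (D W : Set X) (Φ : X → X), HolRange.IsResolvent h (Metric.ball 0 R) lam D W Φ ∧
        ∀ z : X, (1 / r) * (HolRange.omegaFn h R NR.toReal r + ‖z‖) < lam.re →
          z ∈ W ∧ Φ z ∈ Metric.ball 0 r) ∧
    -- (ii)
    (∀ r ∈ Ioo 0 R, ∀ lam : ℝ, HolRange.muFn h R NR.toReal r < lam →
      ∀ y ∈ Metric.ball (0 : X) r,
        ∃! x : X, x ∈ Metric.ball 0 r ∧
          (lam : ℂ) • x - h x = ((lam - HolRange.muFn h R NR.toReal r : ℝ) : ℂ) • y) ∧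
    -- (iii)
    (h 0 = 0 →
      (¬ ∃ r₀ ∈ Ioo 0 R, ∀ᶠ r in 𝓝[≠] r₀,
        HolRange.muFn h R NR.toReal r₀ < HolRange.muFn h R NR.toReal r) ∧
      (NR.toReal = R ^ 2 * HolRange.derivSup h →
        ∀ r ∈ Ioo 0 R, HolRange.muFn h R NR.toReal r = HolRange.derivSup h) ∧
      (NR.toReal ≠ R ^ 2 * HolRange.derivSup h →
        StrictMonoOn (HolRange.muFn h R NR.toReal) (Ioo 0 R))) ∧
    -- (iv)
    (h 0 ≠ 0 →
      ((HolRange.rStar h R NR.toReal ∈ Ioo 0 R ∧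
          IsMinOn (HolRange.muFn h R NR.toReal) (Ioo 0 R) (HolRange.rStar h R NR.toReal)) ↔
        4 * ‖h 0‖ < R * (NR.toReal / R ^ 2 - HolRange.derivSup h)) ∧
      ((∃ r₀ ∈ Ioo 0 R, IsLocalMin (HolRange.muFn h R NR.toReal) r₀) →
        4 * ‖h 0‖ < R * (NR.toReal / R ^ 2 - HolRange.derivSup h))) := by
  have hN := HolRange.isBoundaryBound_toReal hR hh hNR hfin
  have hNL := hN.sq_mul_derivSup_le hR hh
  refine ⟨fun r hr z lam hlam => (hN.existsUnique hh hr hlam).1,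
    fun r hr lam hlam => hN.exists_isResolvent hh hr hlam, fun r hr lam hlam y hy => ?_,
    fun h0 => ⟨HolRange.not_strict_localMin h0 hNL,
      fun heq r hr => HolRange.muFn_eq_derivSup h0 heq hr,
      fun hne => HolRange.strictMonoOn_muFn h0 (lt_of_le_of_ne hNL hne.symm)⟩,
    fun h0 => ⟨⟨fun hmin => HolRange.lt_of_isLocalMin h0 hmin.1
        (hmin.2.isLocalMin (isOpen_Ioo.mem_nhds hmin.1)),
      HolRange.rStar_mem_and_isMinOn hR h0⟩,
      fun ⟨r₀, hr₀, hmin⟩ => HolRange.lt_of_isLocalMin h0 hr₀ hmin⟩⟩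
  refine (hN.existsUnique hh hr ?_).1
  have hpos : 0 < lam - HolRange.muFn h R NR.toReal r := sub_pos.2 hlam
  have hr0 : 0 < r := hr.1
  rw [mem_ball_zero_iff] at hy
  have hω : HolRange.omegaFn h R NR.toReal r = r * HolRange.muFn h R NR.toReal r := by
    rw [HolRange.muFn, mul_div_cancel₀ _ hr0.ne']
  rw [norm_smul, Complex.norm_real, Real.norm_of_nonneg hpos.le, Complex.ofReal_re, one_div,
    inv_mul_lt_iff₀ hr0, hω]
  linarith [mul_lt_mul_of_pos_left hy hpos]
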